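/- Let $k$ be a field and $H$ a Hopf algebra over $k$ with antipode $S$ (not assumed invertible). Let $(C(H),p)$ be the cofree $k$-coalgebra over the vector space $H$: $C(H)$ is a coalgebra and $p:C(H)\to H$ is a linear map such that every linear map $f:D\to H$ from a coalgebra $D$ factors as $f=p\circ\overline f$ for a unique coalgebra map $\overline f:D\to C(H)$. A linear map $\omega:D\to H$ from a coalgebra $D$ is called a partial corepresentation if for all $c\in D$ $$\epsilon_H(\omega(c))=\epsilon_D(c),$$ $$\omega(c_{(1)})_{(1)}\otimes\omega(c_{(1)})_{(2)}S(\omega(c_{(2)}))=\omega(c_{(1)})\otimes\omega(c_{(2)})S(\omega(c_{(3)})),$$ $$\omega(c_{(1)})S(\omega(c_{(2)})_{(1)})\otimes\omega(c_{(2)})_{(2)}=\omega(c_{(1)})S(\omega(c_{(2)}))\otimes\omega(c_{(3)}).$$ Let $H^{par}$ be the sum of all subcoalgebras $X\subseteq C(H)$ such that $p|_X$ is a partial corepresentation; it is a subcoalgebra of $C(H)$. Define $E:H^{par}\to H$ by $E(x)=p(x_{(1)})S(p(x_{(2)}))$, let $\overline E:H^{par}\to C(H)$ be the unique coalgebra map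 with $p\circ\overline E=E$, and let $C=\overline E(H^{par})$, a subcoalgebra of $C(H)$ (the base coalgebra of $H^{par}$). Then there is a well defined (hence unique) $k$-linear map $\lambda:C\to H\otimes C$ with $$\lambda(\overline E(x))=p(x_{(1)})\,S(p(x_{(3)}))\otimes\overline E(x_{(2)})\qquad\text{for all }x\in H^{par},$$ and $\lambda$ makes $C$ a symmetric partial left $H$-comodule coalgebra; that is, writing $\lambda(c)=c^{[-1]}\otimes c^{[0]}$, for all $c\in C$: 1. $c^{[-1]}\otimes {c^{[0]}}_{(1)}\otimes {c^{[0]}}_{(2)}={c_{(1)}}^{[-1]}{c_{(2)}}^{[-1]}\otimes{c_{(1)}}^{[0]}\otimes{c_{(2)}}^{[0]}$; 2. $\epsilon_H(c^{[-1]})\,c^{[0]}=c$; 3. $c^{[-1]}\otimes c^{[0][-1]}\otimes c^{[0][0]}={c_{(1)}}^{[-1]}\epsilon_C({c_{(1)}}^{[0]}){{c_{(2)}}^{[-1]}}_{(1)}\otimes{{c_{(2)}}^{[-1]}}_{(2)}\otimes{c_{(2)}}^{[0]}={{c_{(1)}}^{[-1]}}_{(1)}{c_{(2)}}^{[-1]}\epsilon_C({c_{(2)}}^{[0]})\otimes{{c_{(1)}}^{[-1]}}_{(2)}\otimes{c_{(1)}}^{[0]}$.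 -/

import Mathlib

open scoped TensorProduct

noncomputable section

namespace PartialHopf

universe u v w

/-! ### Coalgebras of linear functionals on an algebra -/

section DualCoalgebra

variable {k : Type u} [Field k]

theorem tensorMap_injective {M M' : Type v} {N N' : Type w} [AddCommMonoid M] [Module k M]
    [AddCommMonoid M'] [Module k M'] [AddCommMonoid N] [Module k N] [AddCommMonoid N']
    [Module k N'] (f : M →ₗ[k] M') (g : N →ₗ[k] N') (hf : Function.Injective f)
    (hg : Function.Injective g) : Function.Injective (TensorProduct.map f g) := by
  let _ := Module.addCommMonoidToAddCommGroup k (M := M)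
  let _ := Module.addCommMonoidToAddCommGroup k (M := M')
  let _ := Module.addCommMonoidToAddCommGroup k (M := N)
  let _ := Module.addCommMonoidToAddCommGroup k (M := N')
  exact TensorProduct.map_injective_of_flat_flat f g hf hg

/-- Over a field the canonical map `M* ⊗ N* → (M ⊗ N)*` is injective. -/
theorem dualDistrib_injective (M : Type v) (N : Type w) [AddCommGroup M] [Module k M]
    [AddCommGroup N] [Module k N] :
    Function.Injective (TensorProduct.dualDistrib k M N) := by
  rw [injective_iff_map_eq_zero]
  intro t ht
  let b := Module.Free.chooseBasis k (Module.Dual k M)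
  obtain ⟨c, rfl⟩ := TensorProduct.eq_repr_basis_left b t
  have hc : c = 0 := by
    ext i n
    have h1 : (c.sum fun j y => y n • b j) = 0 := by
      ext m
      have := LinearMap.congr_fun ht (m ⊗ₜ[k] n)
      simpa [Finsupp.sum, LinearMap.sum_apply, TensorProduct.dualDistrib_apply, mul_comm]
        using this
    by_cases hi : i ∈ c.support
    · exact linearIndependent_iff'.1 b.linearIndependent c.support (fun j => c j n) h1 i hi
    · simp [Finsupp.notMem_support_iff.1 hi]
  simp [hc]

variable {A : Type v} [Ring A] [Algebra k A]

/-- The pairing of `W ⊗ W` with `A ⊗ A`, for a space `W` of linear functionals on `A`. -/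
def dualPairing (W : Submodule k (Module.Dual k A)) : W ⊗[k] W →ₗ[k] Module.Dual k (A ⊗[k] A) :=
  TensorProduct.dualDistrib k A A ∘ₗ TensorProduct.map W.subtype W.subtype

theorem dualPairing_tmul (W : Submodule k (Module.Dual k A)) (φ ψ : W) (a b : A) :
    dualPairing W (φ ⊗ₜ ψ) (a ⊗ₜ b) = φ.1 a * ψ.1 b := by
  simp [dualPairing]

theorem dualPairing_injective (W : Submodule k (Module.Dual k A)) :
    Function.Injective (dualPairing W) :=
  (dualDistrib_injective A A).comp (tensorMap_injective W.subtype W.subtype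
    W.subtype_injective W.subtype_injective)

/-- A space `W` of linear functionals on an algebra is comultiplicative if for each `φ ∈ W` the
functional `a ⊗ b ↦ φ (a * b)` belongs to the image of `W ⊗ W`. -/
def IsComultiplicative (W : Submodule k (Module.Dual k A)) : Prop :=
  ∀ φ ∈ W, φ ∘ₗ LinearMap.mul' k A ∈ LinearMap.range (dualPairing W)

/-- The comultiplication of a comultiplicative space of functionals:
`∑ φ₁ a * φ₂ b = φ (a * b)`. -/
def dualComul (W : Submodule k (Module.Dual k A)) (hW : IsComultiplicative W) :
    W →ₗ[k] W ⊗[k] W :=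
  (LinearEquiv.ofInjective (dualPairing W) (dualPairing_injective W)).symm.toLinearMap ∘ₗ
    LinearMap.codRestrict (LinearMap.range (dualPairing W))
      (LinearMap.lcomp k k (LinearMap.mul' k A) ∘ₗ W.subtype) (fun φ => hW φ.1 φ.2)

theorem dualPairing_dualComul (W : Submodule k (Module.Dual k A)) (hW : IsComultiplicative W)
    (φ : W) (a b : A) : dualPairing W (dualComul W hW φ) (a ⊗ₜ b) = φ.1 (a * b) := by
  have h := congrArg Subtype.val ((LinearEquiv.ofInjective (dualPairing W)
    (dualPairing_injective W)).apply_symm_apply (LinearMap.codRestrict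
      (LinearMap.range (dualPairing W)) (LinearMap.lcomp k k (LinearMap.mul' k A) ∘ₗ W.subtype)
      (fun φ => hW φ.1 φ.2) φ))
  have h2 := LinearMap.congr_fun h (a ⊗ₜ b)
  rw [LinearEquiv.ofInjective_apply] at h2
  exact h2

/-- The counit of a space of functionals: evaluation at `1`. -/
def dualCounit (W : Submodule k (Module.Dual k A)) : W →ₗ[k] k :=
  LinearMap.applyₗ (1 : A) ∘ₗ W.subtype

theorem dualCounit_apply (W : Submodule k (Module.Dual k A)) (φ : W) :
    dualCounit W φ = φ.1 1 := rfl

/-- The coalgebra structure on a comultiplicative space of functionals. -/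
abbrev dualCoalgebra (W : Submodule k (Module.Dual k A)) (hW : IsComultiplicative W) :
    Coalgebra k W where
  comul := dualComul W hW
  counit := dualCounit W
  coassoc := by
    have hJ : Function.Injective (TensorProduct.dualDistrib k A (A ⊗[k] A) ∘ₗ
        TensorProduct.map W.subtype (dualPairing W)) :=
      (dualDistrib_injective A (A ⊗[k] A)).comp (tensorMap_injective W.subtype (dualPairing W)
        W.subtype_injective (dualPairing_injective W))
    have key1 : ∀ (t : W ⊗[k] W) (a b c : A), (TensorProduct.dualDistrib k A (A ⊗[k] A) ∘ₗ
        TensorProduct.map W.subtype (dualPairing W)) ((dualComul W hW).lTensor W t)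
          (a ⊗ₜ (b ⊗ₜ c)) = dualPairing W t (a ⊗ₜ (b * c)) := by
      intro t a b c
      induction t with
      | zero => simp
      | add x y hx hy => simp only [map_add, LinearMap.add_apply, hx, hy]
      | tmul φ ψ => simp [dualPairing_tmul, dualPairing_dualComul]
    have key0 : ∀ (s : W ⊗[k] W) (ψ : W) (a b c : A),
        (TensorProduct.dualDistrib k A (A ⊗[k] A) ∘ₗ
        TensorProduct.map W.subtype (dualPairing W)) (TensorProduct.assoc k W W W (s ⊗ₜ ψ))
          (a ⊗ₜ (b ⊗ₜ c)) = dualPairing W s (a ⊗ₜ b) * ψ.1 c := by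
      intro s ψ a b c
      induction s with
      | zero => simp
      | add x y hx hy =>
        simp only [map_add, LinearMap.add_apply, TensorProduct.add_tmul, hx, hy, add_mul]
      | tmul φ χ => simp [dualPairing_tmul, mul_assoc]
    have key2 : ∀ (t : W ⊗[k] W) (a b c : A), (TensorProduct.dualDistrib k A (A ⊗[k] A) ∘ₗ
        TensorProduct.map W.subtype (dualPairing W))
          (TensorProduct.assoc k W W W ((dualComul W hW).rTensor W t))
          (a ⊗ₜ (b ⊗ₜ c)) = dualPairing W t ((a * b) ⊗ₜ c) := by
      intro t a b c
      induction t with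
      | zero => simp
      | add x y hx hy => simp only [map_add, LinearMap.add_apply, hx, hy]
      | tmul φ ψ =>
        rw [LinearMap.rTensor_tmul, key0, dualPairing_tmul, dualPairing_dualComul]
    ext1 φ
    apply hJ
    apply TensorProduct.ext'
    intro a x
    induction x with
    | zero => simp
    | add x y hx hy => simp only [TensorProduct.tmul_add, map_add, hx, hy]
    | tmul b c =>
      simp only [LinearMap.comp_apply, LinearEquiv.coe_coe] at key1 key2 ⊢
      rw [key1, key2, dualPairing_dualComul, dualPairing_dualComul, mul_assoc]
  rTensor_counit_comp_comul := by
    have key : ∀ (t : W ⊗[k] W) (b : A),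
        (TensorProduct.lid k W ((dualCounit W).rTensor W t)).1 b = dualPairing W t (1 ⊗ₜ b) := by
      intro t b
      induction t with
      | zero => simp
      | add x y hx hy => simp only [map_add, LinearMap.add_apply, Submodule.coe_add, hx, hy]
      | tmul φ ψ => simp [dualPairing_tmul, dualCounit_apply]
    ext1 φ
    apply (TensorProduct.lid k W).injective
    ext b
    simp only [LinearMap.comp_apply]
    rw [key, dualPairing_dualComul]
    simp
  lTensor_counit_comp_comul := by
    have key : ∀ (t : W ⊗[k] W) (b : A),
        (TensorProduct.rid k W ((dualCounit W).lTensor W t)).1 b = dualPairing W t (b ⊗ₜ 1) := by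
      intro t b
      induction t with
      | zero => simp
      | add x y hx hy => simp only [map_add, LinearMap.add_apply, Submodule.coe_add, hx, hy]
      | tmul φ ψ => simp [dualPairing_tmul, dualCounit_apply, mul_comm]
    ext1 φ
    apply (TensorProduct.rid k W).injective
    ext b
    simp only [LinearMap.comp_apply]
    rw [key, dualPairing_dualComul]
    simp

end DualCoalgebra

/-! ### The cofree coalgebra over a vector space -/

section Cofree

variable (k : Type u) [Field k] (V : Type v) [AddCommGroup V] [Module k V]

/-- The underlying space of the cofree coalgebra over `V`: the sum of all comultiplicative spaces
of linear functionals on the tensor algebra `T(V*)` whose restriction to `V*` is given by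
evaluation at vectors of `V`. -/
def cofreeSubmodule : Submodule k (Module.Dual k (TensorAlgebra k (Module.Dual k V))) :=
  sSup {W | IsComultiplicative W ∧ ∀ φ ∈ W,
    φ ∘ₗ TensorAlgebra.ι k ∈ LinearMap.range (Module.Dual.eval k V)}

variable {k} in
theorem dualPairing_range_mono {A : Type v} [Ring A] [Algebra k A]
    {W W' : Submodule k (Module.Dual k A)} (h : W ≤ W') :
    LinearMap.range (dualPairing W) ≤ LinearMap.range (dualPairing W') := by
  rintro _ ⟨t, rfl⟩
  refine ⟨TensorProduct.map (Submodule.inclusion h) (Submodule.inclusion h) t, ?_⟩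
  induction t with
  | zero => simp
  | add x y hx hy => simp only [map_add, hx, hy]
  | tmul φ ψ => simp [dualPairing]

theorem cofreeSubmodule_isComultiplicative : IsComultiplicative (cofreeSubmodule k V) := by
  intro φ hφ
  have h : cofreeSubmodule k V ≤ Submodule.comap
      (LinearMap.lcomp k k (LinearMap.mul' k (TensorAlgebra k (Module.Dual k V))))
      (LinearMap.range (dualPairing (cofreeSubmodule k V))) :=
    sSup_le fun W hW ψ hψ => dualPairing_range_mono (le_sSup hW) (hW.1 ψ hψ)
  exact h hφ

theorem cofreeSubmodule_comp_ι_mem (φ : cofreeSubmodule k V) :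
    φ.1 ∘ₗ TensorAlgebra.ι k ∈ LinearMap.range (Module.Dual.eval k V) := by
  have h : cofreeSubmodule k V ≤ Submodule.comap
      (LinearMap.lcomp k k (TensorAlgebra.ι k)) (LinearMap.range (Module.Dual.eval k V)) :=
    sSup_le fun W hW ψ hψ => hW.2 ψ hψ
  exact h φ.2

/-- The cofree coalgebra `C(V)` over the vector space `V`. -/
def CofreeCoalgebra : Type (max u v) := cofreeSubmodule k V

instance : AddCommGroup (CofreeCoalgebra k V) := inferInstanceAs (AddCommGroup (cofreeSubmodule k V))

instance : Module k (CofreeCoalgebra k V) := inferInstanceAs (Module k (cofreeSubmodule k V))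

instance : Coalgebra k (CofreeCoalgebra k V) :=
  dualCoalgebra (cofreeSubmodule k V) (cofreeSubmodule_isComultiplicative k V)

theorem dualEval_injective : Function.Injective (Module.Dual.eval k V) :=
  LinearMap.ker_eq_bot.1 (Module.eval_ker k V)

/-- The canonical projection `p : C(V) → V`. -/
def cofreeProj : CofreeCoalgebra k V →ₗ[k] V :=
  (LinearEquiv.ofInjective _ (dualEval_injective k V)).symm.toLinearMap ∘ₗ
    LinearMap.codRestrict (LinearMap.range (Module.Dual.eval k V))
      (LinearMap.lcomp k k (TensorAlgebra.ι k) ∘ₗ (cofreeSubmodule k V).subtype)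
      (cofreeSubmodule_comp_ι_mem k V)

theorem apply_cofreeProj (φ : CofreeCoalgebra k V) (ξ : Module.Dual k V) :
    ξ (cofreeProj k V φ) = φ.1 (TensorAlgebra.ι k ξ) := by
  have h := congrArg Subtype.val ((LinearEquiv.ofInjective _
    (dualEval_injective k V)).apply_symm_apply (LinearMap.codRestrict
      (LinearMap.range (Module.Dual.eval k V))
      (LinearMap.lcomp k k (TensorAlgebra.ι k) ∘ₗ (cofreeSubmodule k V).subtype)
      (cofreeSubmodule_comp_ι_mem k V) φ))
  have h2 := LinearMap.congr_fun h ξ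
  rw [LinearEquiv.ofInjective_apply] at h2
  exact h2

variable {k V}

section Lift

variable {D : Type w} [AddCommGroup D] [Module k D] [Coalgebra k D] (f : D →ₗ[k] V)

/-- The algebra map `T(V*) → D*` (convolution product on `D*`) extending `ξ ↦ ξ ∘ f`. -/
def cofreeLiftAlg : TensorAlgebra k (Module.Dual k V) →ₐ[k] WithConv (D →ₗ[k] k) :=
  TensorAlgebra.lift k
    ((WithConv.linearEquiv k (D →ₗ[k] k)).symm.toLinearMap ∘ₗ LinearMap.lcomp k k f)

/-- The transpose `D → T(V*)*` of `T(V*) → D*`. -/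
def cofreeLiftAux : D →ₗ[k] Module.Dual k (TensorAlgebra k (Module.Dual k V)) :=
  ((WithConv.linearEquiv k (D →ₗ[k] k)).toLinearMap ∘ₗ (cofreeLiftAlg f).toLinearMap).flip

theorem cofreeLiftAux_apply (d : D) (a : TensorAlgebra k (Module.Dual k V)) :
    cofreeLiftAux f d a = (cofreeLiftAlg f a).ofConv d := rfl

theorem cofreeLiftAux_ι (d : D) (ξ : Module.Dual k V) :
    cofreeLiftAux f d (TensorAlgebra.ι k ξ) = ξ (f d) := by
  simp [cofreeLiftAux_apply, cofreeLiftAlg]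

theorem cofreeLiftAux_one (d : D) : cofreeLiftAux f d 1 = Coalgebra.counit (R := k) d := by
  simp [cofreeLiftAux_apply]

theorem cofreeLiftAux_mul (d : D) (a b : TensorAlgebra k (Module.Dual k V)) :
    cofreeLiftAux f d (a * b) = TensorProduct.dualDistrib k _ _
      (TensorProduct.map (cofreeLiftAux f) (cofreeLiftAux f) (Coalgebra.comul d)) (a ⊗ₜ b) := by
  rw [cofreeLiftAux_apply, map_mul, LinearMap.convMul_apply]
  generalize (Coalgebra.comul d : D ⊗[k] D) = t
  induction t with
  | zero => simp
  | add x y hx hy => simp only [map_add, LinearMap.add_apply, hx, hy]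
  | tmul x y => simp [cofreeLiftAux_apply]

theorem dualPairing_map_codRestrict {D : Type w} [AddCommGroup D] [Module k D]
    {A : Type*} [Ring A] [Algebra k A] {W : Submodule k (Module.Dual k A)} (g : D →ₗ[k] Module.Dual k A) (hg : ∀ d, g d ∈ W)
    (t : D ⊗[k] D) : dualPairing W (TensorProduct.map (g.codRestrict W hg) (g.codRestrict W hg) t)
      = TensorProduct.dualDistrib k A A (TensorProduct.map g g t) := by
  induction t with
  | zero => simp
  | add x y hx hy => simp only [map_add, hx, hy]
  | tmul x y => simp [dualPairing]

theorem cofreeLiftAux_mem (d : D) : cofreeLiftAux f d ∈ cofreeSubmodule k V := by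
  have h : LinearMap.range (cofreeLiftAux f) ≤ cofreeSubmodule k V := by
    refine le_sSup ⟨?_, ?_⟩
    · rintro _ ⟨d, rfl⟩
      refine ⟨TensorProduct.map ((cofreeLiftAux f).codRestrict _ (LinearMap.mem_range_self _))
        ((cofreeLiftAux f).codRestrict _ (LinearMap.mem_range_self _)) (Coalgebra.comul d), ?_⟩
      rw [dualPairing_map_codRestrict]
      apply TensorProduct.ext'
      intro a b
      simp [cofreeLiftAux_mul]
    · rintro _ ⟨d, rfl⟩
      refine ⟨f d, ?_⟩
      ext ξ
      simp [cofreeLiftAux_ι]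
  exact h (LinearMap.mem_range_self _ d)

/-- The coalgebra map `D → C(V)` induced by a linear map `f : D → V`. -/
def cofreeLift : D →ₗc[k] CofreeCoalgebra k V where
  toLinearMap := (cofreeLiftAux f).codRestrict (cofreeSubmodule k V) (cofreeLiftAux_mem f)
  counit_comp := by
    ext d
    exact cofreeLiftAux_one f d
  map_comp_comul := by
    apply LinearMap.ext
    intro d
    apply dualPairing_injective (cofreeSubmodule k V)
    apply TensorProduct.ext'
    intro a b
    refine Eq.trans ?_ (dualPairing_dualComul _ (cofreeSubmodule_isComultiplicative k V)
      ((cofreeLiftAux f).codRestrict (cofreeSubmodule k V) (cofreeLiftAux_mem f) d) a b).symm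
    refine Eq.trans ?_ (cofreeLiftAux_mul f d a b).symm
    exact LinearMap.congr_fun (dualPairing_map_codRestrict _ (cofreeLiftAux_mem f) _) _

theorem cofreeProj_cofreeLift (d : D) : cofreeProj k V (cofreeLift f d) = f d := by
  apply dualEval_injective k V
  ext ξ
  exact (apply_cofreeProj k V _ ξ).trans (cofreeLiftAux_ι f d ξ)

/-- The universal property of the cofree coalgebra. -/
theorem existsUnique_cofreeLift : ∃! F : D →ₗc[k] CofreeCoalgebra k V,
    ∀ d, cofreeProj k V (F d) = f d := by
  refine ⟨cofreeLift f, cofreeProj_cofreeLift f, ?_⟩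
  intro F hF
  let L : D →ₗ[k] cofreeSubmodule k V := F.toLinearMap
  have hcounit : ∀ d, (L d).1 1 = Coalgebra.counit (R := k) d :=
    fun d => LinearMap.congr_fun F.counit_comp d
  have hmul : ∀ d a b, (L d).1 (a * b) =
      dualPairing (cofreeSubmodule k V) (TensorProduct.map L L (Coalgebra.comul d)) (a ⊗ₜ b) := by
    intro d a b
    rw [← dualPairing_dualComul _ (cofreeSubmodule_isComultiplicative k V)]
    exact congrArg (fun t => dualPairing (cofreeSubmodule k V) t (a ⊗ₜ b))
      (LinearMap.congr_fun F.map_comp_comul d).symm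
  have key : ∀ a d, (L d).1 a = cofreeLiftAux f d a := by
    intro a
    induction a using TensorAlgebra.induction with
    | algebraMap r =>
      intro d
      rw [Algebra.algebraMap_eq_smul_one, map_smul, map_smul, hcounit, cofreeLiftAux_one]
    | ι ξ =>
      intro d
      rw [cofreeLiftAux_ι, ← hF d]
      exact (apply_cofreeProj k V (F d) ξ).symm
    | add a b ha hb => intro d; rw [map_add, map_add, ha, hb]
    | mul a b ha hb =>
      intro d
      rw [hmul, cofreeLiftAux_mul]
      generalize (Coalgebra.comul d : D ⊗[k] D) = t
      induction t with
      | zero => simp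
      | add x y hx hy => simp only [map_add, LinearMap.add_apply, hx, hy]
      | tmul x y => simp [dualPairing_tmul, ha, hb]
  ext d
  exact Subtype.ext (LinearMap.ext fun a => key a d)

end Lift

end Cofree

/-! ### Subcoalgebras -/

section Subcoalgebra

variable (k : Type u) [Field k] (D : Type v) [AddCommGroup D] [Module k D] [Coalgebra k D]

/-- A subcoalgebra of `D`: a subspace `X` with `Δ(X) ⊆ X ⊗ X`. -/
structure Subcoalgebra extends Submodule k D where
  comul_mem' : ∀ x ∈ toSubmodule, (Coalgebra.comul x : D ⊗[k] D) ∈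
    LinearMap.range (TensorProduct.map toSubmodule.subtype toSubmodule.subtype)

variable {k D}

namespace Subcoalgebra

variable (X : Subcoalgebra k D)

theorem map_subtype_injective :
    Function.Injective (TensorProduct.map X.toSubmodule.subtype X.toSubmodule.subtype) :=
  tensorMap_injective _ _ X.toSubmodule.subtype_injective X.toSubmodule.subtype_injective

/-- The restriction of the comultiplication of `D` to a subcoalgebra. -/
def comulRestrict : X.toSubmodule →ₗ[k] X.toSubmodule ⊗[k] X.toSubmodule :=
  (LinearEquiv.ofInjective _ X.map_subtype_injective).symm.toLinearMap ∘ₗ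
    LinearMap.codRestrict _ (Coalgebra.comul ∘ₗ X.toSubmodule.subtype)
      (fun x => X.comul_mem' x.1 x.2)

theorem map_subtype_comulRestrict (x : X.toSubmodule) :
    TensorProduct.map X.toSubmodule.subtype X.toSubmodule.subtype (X.comulRestrict x) =
      Coalgebra.comul x.1 := by
  have h := congrArg Subtype.val ((LinearEquiv.ofInjective _
    X.map_subtype_injective).apply_symm_apply
      (LinearMap.codRestrict _ (Coalgebra.comul ∘ₗ X.toSubmodule.subtype)
        (fun x => X.comul_mem' x.1 x.2) x))
  rw [LinearEquiv.ofInjective_apply] at h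
  exact h

instance : Coalgebra k X.toSubmodule where
  comul := X.comulRestrict
  counit := Coalgebra.counit ∘ₗ X.toSubmodule.subtype
  coassoc := by
    have hJ : Function.Injective (TensorProduct.map X.toSubmodule.subtype
        (TensorProduct.map X.toSubmodule.subtype X.toSubmodule.subtype)) :=
      tensorMap_injective _ _ X.toSubmodule.subtype_injective X.map_subtype_injective
    have key0 : ∀ (s : X.toSubmodule ⊗[k] X.toSubmodule) (y : X.toSubmodule),
        TensorProduct.map X.toSubmodule.subtype
          (TensorProduct.map X.toSubmodule.subtype X.toSubmodule.subtype)
          (TensorProduct.assoc k _ _ _ (s ⊗ₜ y)) = TensorProduct.assoc k _ _ _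
            (TensorProduct.map X.toSubmodule.subtype X.toSubmodule.subtype s ⊗ₜ y.1) := by
      intro s y
      induction s with
      | zero => simp
      | add a b ha hb => simp only [map_add, TensorProduct.add_tmul, ha, hb]
      | tmul a b => simp
    have key1 : ∀ t : X.toSubmodule ⊗[k] X.toSubmodule, TensorProduct.map X.toSubmodule.subtype
        (TensorProduct.map X.toSubmodule.subtype X.toSubmodule.subtype)
        (X.comulRestrict.lTensor _ t) = Coalgebra.comul.lTensor D
          (TensorProduct.map X.toSubmodule.subtype X.toSubmodule.subtype t) := by
      intro t
      induction t with
      | zero => simp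
      | add a b ha hb => simp only [map_add, ha, hb]
      | tmul a b => simp [map_subtype_comulRestrict]
    have key2 : ∀ t : X.toSubmodule ⊗[k] X.toSubmodule, TensorProduct.map X.toSubmodule.subtype
        (TensorProduct.map X.toSubmodule.subtype X.toSubmodule.subtype)
        (TensorProduct.assoc k _ _ _ (X.comulRestrict.rTensor _ t)) = TensorProduct.assoc k _ _ _
          (Coalgebra.comul.rTensor D
            (TensorProduct.map X.toSubmodule.subtype X.toSubmodule.subtype t)) := by
      intro t
      induction t with
      | zero => simp
      | add a b ha hb => simp only [map_add, ha, hb]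
      | tmul a b => rw [LinearMap.rTensor_tmul, key0, map_subtype_comulRestrict]; simp
    apply LinearMap.ext
    intro x
    apply hJ
    simp only [LinearMap.comp_apply, LinearEquiv.coe_coe]
    rw [key1, key2, map_subtype_comulRestrict, Coalgebra.coassoc_apply]
  rTensor_counit_comp_comul := by
    have key : ∀ t : X.toSubmodule ⊗[k] X.toSubmodule, (TensorProduct.lid k _
        ((Coalgebra.counit ∘ₗ X.toSubmodule.subtype).rTensor _ t)).1 = TensorProduct.lid k D
          (Coalgebra.counit.rTensor D
            (TensorProduct.map X.toSubmodule.subtype X.toSubmodule.subtype t)) := by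
      intro t
      induction t with
      | zero => simp
      | add a b ha hb => simp only [map_add, Submodule.coe_add, ha, hb]
      | tmul a b => simp
    apply LinearMap.ext
    intro x
    apply (TensorProduct.lid k X.toSubmodule).injective
    apply Subtype.ext
    rw [LinearMap.comp_apply, key, map_subtype_comulRestrict]
    simp
  lTensor_counit_comp_comul := by
    have key : ∀ t : X.toSubmodule ⊗[k] X.toSubmodule, (TensorProduct.rid k _
        ((Coalgebra.counit ∘ₗ X.toSubmodule.subtype).lTensor _ t)).1 = TensorProduct.rid k D
          (Coalgebra.counit.lTensor D
            (TensorProduct.map X.toSubmodule.subtype X.toSubmodule.subtype t)) := by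
      intro t
      induction t with
      | zero => simp
      | add a b ha hb => simp only [map_add, Submodule.coe_add, ha, hb]
      | tmul a b => simp
    apply LinearMap.ext
    intro x
    apply (TensorProduct.rid k X.toSubmodule).injective
    apply Subtype.ext
    rw [LinearMap.comp_apply, key, map_subtype_comulRestrict]
    simp

/-- The sum of a set of subcoalgebras. -/
def sum (Λ : Set (Subcoalgebra k D)) : Subcoalgebra k D where
  toSubmodule := ⨆ X ∈ Λ, X.toSubmodule
  comul_mem' := by
    set S : Submodule k D := ⨆ X ∈ Λ, X.toSubmodule with hS
    have h : S ≤ (LinearMap.range (TensorProduct.map S.subtype S.subtype)).comap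
        Coalgebra.comul := by
      refine iSup₂_le fun X hX x hx => ?_
      obtain ⟨t, ht⟩ := X.comul_mem' x hx
      have hXS : X.toSubmodule ≤ S := le_iSup₂_of_le X hX le_rfl
      refine ⟨TensorProduct.map (Submodule.inclusion hXS) (Submodule.inclusion hXS) t, ?_⟩
      rw [← ht]
      clear ht
      induction t with
      | zero => simp
      | add a b ha hb => simp only [map_add, ha, hb]
      | tmul a b => simp
    exact fun x hx => h hx

end Subcoalgebra

/-- The image of a coalgebra map, as a subcoalgebra. -/
def rangeSubcoalgebra {B : Type w} [AddCommGroup B] [Module k B] [Coalgebra k B]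
    (f : B →ₗc[k] D) : Subcoalgebra k D where
  toSubmodule := LinearMap.range f.toLinearMap
  comul_mem' := by
    rintro _ ⟨b, rfl⟩
    refine ⟨TensorProduct.map f.toLinearMap.rangeRestrict f.toLinearMap.rangeRestrict
      (Coalgebra.comul b), ?_⟩
    have h := LinearMap.congr_fun f.map_comp_comul b
    simp only [LinearMap.comp_apply] at h
    rw [← h, ← LinearMap.comp_apply, ← TensorProduct.map_comp]
    rfl

end Subcoalgebra

/-! ### Partial corepresentations and partial coactions -/

section Partial

variable {k : Type u} [Field k] {H : Type v} [Ring H]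

section Corep

variable [HopfAlgebra k H] {D : Type w} [AddCommGroup D] [Module k D] [Coalgebra k D]

/-- For `ω : D → H`, the map `c ↦ ω(c₁) S(ω(c₂))`. -/
def idempotentMap (ω : D →ₗ[k] H) : D →ₗ[k] H :=
  LinearMap.mul' k H ∘ₗ TensorProduct.map ω (HopfAlgebra.antipode k ∘ₗ ω) ∘ₗ Coalgebra.comul

/-- A partial corepresentation of the Hopf algebra `H` over the coalgebra `D`. -/
structure IsPartialCorep (ω : D →ₗ[k] H) : Prop where
  /-- `ε(ω(c)) = ε(c)` -/
  counit_comp : Coalgebra.counit ∘ₗ ω = Coalgebra.counit (R := k)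
  /-- `ω(c₁)₁ ⊗ ω(c₁)₂ S(ω(c₂)) = ω(c₁) ⊗ ω(c₂) S(ω(c₃))` -/
  comul_left :
    (LinearMap.mul' k H).lTensor H ∘ₗ (TensorProduct.assoc k H H H).toLinearMap ∘ₗ
        TensorProduct.map (Coalgebra.comul ∘ₗ ω) (HopfAlgebra.antipode k ∘ₗ ω) ∘ₗ Coalgebra.comul =
      TensorProduct.map ω (idempotentMap ω) ∘ₗ Coalgebra.comul
  /-- `ω(c₁) S(ω(c₂)₁) ⊗ ω(c₂)₂ = ω(c₁) S(ω(c₂)) ⊗ ω(c₃)` -/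
  comul_right :
    (LinearMap.mul' k H).rTensor H ∘ₗ (TensorProduct.assoc k H H H).symm.toLinearMap ∘ₗ
        TensorProduct.map ω ((HopfAlgebra.antipode k).rTensor H ∘ₗ Coalgebra.comul ∘ₗ ω) ∘ₗ
          Coalgebra.comul =
      TensorProduct.map (idempotentMap ω) ω ∘ₗ Coalgebra.comul

end Corep

section Coaction

variable [Bialgebra k H] {D : Type w} [AddCommGroup D] [Module k D] [Coalgebra k D]

/-- For `lam(c) = c⁻¹ ⊗ c⁰`, the map `c ↦ c⁻¹ ε(c⁰)`. -/
def coactionNabla (lam : D →ₗ[k] H ⊗[k] D) : D →ₗ[k] H :=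
  (TensorProduct.rid k H).toLinearMap ∘ₗ Coalgebra.counit.lTensor H ∘ₗ lam

/-- For `lam(c) = c⁻¹ ⊗ c⁰`, the map `c ↦ (c⁻¹)₁ ⊗ ((c⁻¹)₂ ⊗ c⁰)`. -/
def comulCoaction (lam : D →ₗ[k] H ⊗[k] D) : D →ₗ[k] H ⊗[k] (H ⊗[k] D) :=
  (TensorProduct.assoc k H H D).toLinearMap ∘ₗ Coalgebra.comul.rTensor D ∘ₗ lam

/-- The map `g ⊗ (h ⊗ t) ↦ g h ⊗ t`. -/
def mulLeftTensor (k : Type u) [Field k] (H : Type v) [Ring H] [Algebra k H]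
    (T : Type w) [AddCommGroup T] [Module k T] : H ⊗[k] (H ⊗[k] T) →ₗ[k] H ⊗[k] T :=
  (LinearMap.mul' k H).rTensor T ∘ₗ (TensorProduct.assoc k H H T).symm.toLinearMap

/-- The map `(h ⊗ t) ⊗ g ↦ h g ⊗ t`. -/
def mulRightTensor (k : Type u) [Field k] (H : Type v) [Ring H] [Algebra k H]
    (T : Type w) [AddCommGroup T] [Module k T] : (H ⊗[k] T) ⊗[k] H →ₗ[k] H ⊗[k] T :=
  (LinearMap.mul' k H).rTensor T ∘ₗ (TensorProduct.rightComm k H T H).toLinearMap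

/-- `lam : D → H ⊗ D`, `lam(c) = c⁻¹ ⊗ c⁰`, is a symmetric left partial coaction of the bialgebra
`H` on the coalgebra `D`, that is, it makes `D` a symmetric partial left `H`-comodule
coalgebra. -/
structure IsSymmetricPartialCoaction (lam : D →ₗ[k] H ⊗[k] D) : Prop where
  /-- `c⁻¹ ⊗ (c⁰)₁ ⊗ (c⁰)₂ = (c₁)⁻¹ (c₂)⁻¹ ⊗ (c₁)⁰ ⊗ (c₂)⁰` -/
  comul_comp : Coalgebra.comul.lTensor H ∘ₗ lam =
    (LinearMap.mul' k H).rTensor (D ⊗[k] D) ∘ₗ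
      (TensorProduct.tensorTensorTensorComm k H D H D).toLinearMap ∘ₗ
        TensorProduct.map lam lam ∘ₗ Coalgebra.comul
  /-- `ε(c⁻¹) c⁰ = c` -/
  counit_comp : (TensorProduct.lid k D).toLinearMap ∘ₗ Coalgebra.counit.rTensor D ∘ₗ lam =
    LinearMap.id
  /-- `c⁻¹ ⊗ (c⁰)⁻¹ ⊗ (c⁰)⁰ = (c₁)⁻¹ ε((c₁)⁰) ((c₂)⁻¹)₁ ⊗ ((c₂)⁻¹)₂ ⊗ (c₂)⁰` -/
  coassoc_left : lam.lTensor H ∘ₗ lam = mulLeftTensor k H (H ⊗[k] D) ∘ₗ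
    TensorProduct.map (coactionNabla lam) (comulCoaction lam) ∘ₗ Coalgebra.comul
  /-- `c⁻¹ ⊗ (c⁰)⁻¹ ⊗ (c⁰)⁰ = ((c₁)⁻¹)₁ (c₂)⁻¹ ε((c₂)⁰) ⊗ ((c₁)⁻¹)₂ ⊗ (c₁)⁰` -/
  coassoc_right : lam.lTensor H ∘ₗ lam = mulRightTensor k H (H ⊗[k] D) ∘ₗ
    TensorProduct.map (comulCoaction lam) (coactionNabla lam) ∘ₗ Coalgebra.comul

end Coaction

end Partial

/-! ### The universal corep-coalgebra and its base coalgebra -/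

section Universal

variable (k : Type u) [Field k] (H : Type v) [Ring H] [HopfAlgebra k H]

/-- The universal corep-coalgebra `H^par`: the sum of all subcoalgebras `X` of `C(H)` such that
the restriction of `p : C(H) → H` to `X` is a partial corepresentation. -/
def hpar : Subcoalgebra k (CofreeCoalgebra k H) :=
  Subcoalgebra.sum {X | IsPartialCorep (cofreeProj k H ∘ₗ X.toSubmodule.subtype)}

/-- The space `H^par`. -/
abbrev Hpar : Type (max u v) := (hpar k H).toSubmodule

/-- The restriction of `p` to `H^par`. -/
def hparProj : Hpar k H →ₗ[k] H := cofreeProj k H ∘ₗ (hpar k H).toSubmodule.subtype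

/-- The coalgebra map `H^par → C(H)` induced by `E(x) = p(x₁) S(p(x₂))`. -/
def hparELift : Hpar k H →ₗc[k] CofreeCoalgebra k H :=
  cofreeLift (idempotentMap (hparProj k H))

/-- The base coalgebra `C` of `H^par`, a subcoalgebra of `C(H)`. -/
def baseCoalgebra : Subcoalgebra k (CofreeCoalgebra k H) := rangeSubcoalgebra (hparELift k H)

/-- The space `C`. -/
abbrev Base : Type (max u v) := (baseCoalgebra k H).toSubmodule

/-- The surjection `Ebar : H^par → C`. -/
def hparEbar : Hpar k H →ₗ[k] Base k H := (hparELift k H).toLinearMap.rangeRestrict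

/-- The map `x ↦ p(x₁) S(p(x₃)) ⊗ Ebar(x₂)`. -/
def twistedCoaction : Hpar k H →ₗ[k] H ⊗[k] Base k H :=
  mulRightTensor k H (Base k H) ∘ₗ
    TensorProduct.map (TensorProduct.map (hparProj k H) (hparEbar k H) ∘ₗ Coalgebra.comul)
      (HopfAlgebra.antipode k ∘ₗ hparProj k H) ∘ₗ Coalgebra.comul

end Universal

end PartialHopf

end

/-!
The proof takes place in convolution algebras `Hom(D, H)` and `Hom(D, H ⊗ H)`, where `D = H^par`.
Write `ω` for the restriction of `p` to `D`, `S` for the antipode, `E = ω * Sω`, and `w` for a word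
in the functionals `ξ ∘ E`, with `ξ ∈ H*`. Such words are indexed by the tensor algebra `T(H*)`.
An element of the cofree coalgebra is a functional on `T(H*)`, so an element of the base coalgebra
`C` is determined by the values of all words on it, and every claim about the coaction `λ` can be
tested by slicing with words.

Call `f : D → H` equivariant if `ω(c₁) ⊗ f(c₂) = f(c₁)₁ ω(c₂) ⊗ f(c₁)₂`. The axioms of a partial
corepresentation give `E * ω = ω` (`IsPartialCorep.idempotentMap_mul`) and the equivariance of `E`
(`IsPartialCorep.isEquivariant_idempotentMap`). Equivariant maps are closed under convolution and
under `h ↦ h₁ ξ(h₂)`, hence for each word `w` there is an equivariant map `v`, which factors through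
`Ebar : D → C`, such that `ω * w = v * ω` (`mul_convPre_cofreeLiftAlg`). The slice at `w` of
`x ↦ ω(x₁) S(ω(x₃)) ⊗ Ebar(x₂)` is `ω * w * Sω = v * E`, which factors through `Ebar`. This is why
`λ` is well defined (`exists_comp_eq_twistedMap`).

Compatibility with the comultiplication says that the slices `v * E` are multiplicative in `w`,
which follows from `E * ω = ω` (`coactionSlice_mul`). For the two coassociativity axioms, the slice
of `(id ⊗ λ) λ` is `ω(c₁) S(ω(c₃)) ⊗ f(c₂)` with `f = v * E` equivariant. By equivariance this is
`f(c₁)₁ E(c₂) ⊗ f(c₁)₂` (`IsEquivariant.conj_eq_comul_mul`); applying `a ⊗ b ↦ (S(a) ⊗ 1) Δ(b)` to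
the equivariance relation shows that it is also `E(c₁) f(c₂)₁ ⊗ f(c₂)₂`
(`IsEquivariant.conj_eq_mul_comul`). No inverse of the antipode is needed.
-/

noncomputable section

namespace PartialHopf

open WithConv

/-! ### Convolution algebras -/

section Convolution

variable {k A A' R R' D D' : Type*} [Field k] [Ring A] [Algebra k A] [Ring A'] [Algebra k A']
  [Ring R] [Algebra k R] [Ring R'] [Algebra k R']
  [AddCommGroup D] [Module k D] [Coalgebra k D] [AddCommGroup D'] [Module k D'] [Coalgebra k D']

/-- Composition with an algebra map `A → R`, as an algebra map between the convolution algebras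
`Hom(D, A) → Hom(D, R)`. -/
def convPost (Φ : A →ₐ[k] R) : WithConv (D →ₗ[k] A) →ₐ[k] WithConv (D →ₗ[k] R) :=
  AlgHom.ofLinearMap
    ((WithConv.linearEquiv k (D →ₗ[k] R)).symm.toLinearMap ∘ₗ
      LinearMap.llcomp k D A R Φ.toLinearMap ∘ₗ (WithConv.linearEquiv k (D →ₗ[k] A)).toLinearMap)
    (by ext; simp)
    (fun f g => congrArg toConv (LinearMap.algHom_comp_convMul_distrib Φ f g))

@[simp]
theorem convPost_apply (Φ : A →ₐ[k] R) (f : WithConv (D →ₗ[k] A)) (d : D) :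
    (convPost Φ f).ofConv d = Φ (f.ofConv d) := rfl

/-- Composition with a coalgebra map `D → D'`, as an algebra map between the convolution algebras
`Hom(D', A) → Hom(D, A)`. -/
def convPre (π : D →ₗc[k] D') : WithConv (D' →ₗ[k] A) →ₐ[k] WithConv (D →ₗ[k] A) :=
  AlgHom.ofLinearMap
    ((WithConv.linearEquiv k (D →ₗ[k] A)).symm.toLinearMap ∘ₗ
      LinearMap.lcomp k A π.toLinearMap ∘ₗ (WithConv.linearEquiv k (D' →ₗ[k] A)).toLinearMap)
    (by ext; simp)
    (fun f g => congrArg toConv (LinearMap.convMul_comp_coalgHom_distrib f g π))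

@[simp]
theorem convPre_apply (π : D →ₗc[k] D') (f : WithConv (D' →ₗ[k] A)) (d : D) :
    (convPre π f).ofConv d = f.ofConv (π d) := rfl

theorem convPre_injective {π : D →ₗc[k] D'} (hπ : Function.Surjective π) :
    Function.Injective (convPre (A := A) π) := by
  intro f g h
  ext b
  obtain ⟨d, rfl⟩ := hπ b
  exact LinearMap.congr_fun (congrArg ofConv h) d

theorem convPre_convPost (π : D →ₗc[k] D') (Φ : A →ₐ[k] R) (f : WithConv (D' →ₗ[k] A)) :
    convPre π (convPost Φ f) = convPost Φ (convPre π f) := rfl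

/-- Composition with a linear map `T : R → R'`, as a linear map `Hom(D, R) → Hom(D, R')`. -/
def convComp (T : R →ₗ[k] R') (X : WithConv (D →ₗ[k] R)) : WithConv (D →ₗ[k] R') :=
  toConv (T ∘ₗ X.ofConv)

/-- A map `T : R → R'` that is linear over `A` on the left gives a map `Hom(D, R) → Hom(D, R')` that
is linear over `Hom(D, A)` on the left. -/
theorem convComp_convPost_mul {T : R →ₗ[k] R'} {Φ : A →ₐ[k] R} {Ψ : A →ₐ[k] R'}
    (hT : ∀ a r, T (Φ a * r) = Ψ a * T r) (f : WithConv (D →ₗ[k] A)) (X : WithConv (D →ₗ[k] R)) :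
    convComp T (convPost Φ f * X) = convPost Ψ f * convComp T X := by
  ext d
  simp only [convComp, LinearMap.comp_apply, LinearMap.convMul_apply]
  generalize (Coalgebra.comul d : D ⊗[k] D) = t
  induction t with
  | zero => simp
  | add x y hx hy => simp only [map_add, hx, hy]
  | tmul x y => simp [hT]

theorem convComp_mul_convPost {T : R →ₗ[k] R'} {Φ : A →ₐ[k] R} {Ψ : A →ₐ[k] R'}
    (hT : ∀ r a, T (r * Φ a) = T r * Ψ a) (X : WithConv (D →ₗ[k] R)) (f : WithConv (D →ₗ[k] A)) :
    convComp T (X * convPost Φ f) = convComp T X * convPost Ψ f := by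
  ext d
  simp only [convComp, LinearMap.comp_apply, LinearMap.convMul_apply]
  generalize (Coalgebra.comul d : D ⊗[k] D) = t
  induction t with
  | zero => simp
  | add x y hx hy => simp only [map_add, hx, hy]
  | tmul x y => simp [hT]

theorem convComp_convPost {T : R →ₗ[k] R'} {Φ : A →ₐ[k] R} {Ψ : A →ₐ[k] R'}
    (hT : ∀ a, T (Φ a) = Ψ a) (f : WithConv (D →ₗ[k] A)) :
    convComp T (convPost Φ f) = convPost Ψ f := by
  ext d
  exact hT _

end Convolution

/-! ### Convolution identities of the antipode -/

section Hopf

variable {k H D : Type*} [Field k] [Ring H] [HopfAlgebra k H]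
  [AddCommGroup D] [Module k D] [Coalgebra k D]

/-- `f ↦ f ⊗ 1`, from `Hom(D, H)` to `Hom(D, H ⊗ H)`. -/
abbrev legOne : WithConv (D →ₗ[k] H) →ₐ[k] WithConv (D →ₗ[k] H ⊗[k] H) :=
  convPost Algebra.TensorProduct.includeLeft

/-- `f ↦ 1 ⊗ f`, from `Hom(D, H)` to `Hom(D, H ⊗ H)`. -/
abbrev legTwo : WithConv (D →ₗ[k] H) →ₐ[k] WithConv (D →ₗ[k] H ⊗[k] H) :=
  convPost Algebra.TensorProduct.includeRight

/-- `f ↦ Δ ∘ f`, from `Hom(D, H)` to `Hom(D, H ⊗ H)`. -/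
abbrev convComul : WithConv (D →ₗ[k] H) →ₐ[k] WithConv (D →ₗ[k] H ⊗[k] H) :=
  convPost (Bialgebra.comulAlgHom k H)

/-- `f ↦ S ∘ f` on `Hom(D, H)`. -/
abbrev convAntipode (f : WithConv (D →ₗ[k] H)) : WithConv (D →ₗ[k] H) :=
  convComp (HopfAlgebra.antipode k) f

/-- `Δ(h) = (h₁ ⊗ 1) (1 ⊗ h₂)`. -/
theorem legOne_id_mul_legTwo_id : legOne (toConv (LinearMap.id : H →ₗ[k] H)) *
    legTwo (toConv LinearMap.id) = convComul (toConv LinearMap.id) := by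
  ext h
  simp only [LinearMap.convMul_apply, convPost_apply, Bialgebra.comulAlgHom_apply,
    LinearMap.id_apply]
  generalize (Coalgebra.comul h : H ⊗[k] H) = t
  induction t with
  | zero => simp
  | add x y hx hy => simp only [map_add, hx, hy]
  | tmul x y => simp

/-- `S(h₁) h₂ ⊗ h₃ = 1 ⊗ h`. -/
theorem legOne_antipode_mul_comul :
    legOne (toConv (HopfAlgebra.antipode k (A := H))) * convComul (toConv LinearMap.id) =
      legTwo (toConv LinearMap.id) := by
  rw [← legOne_id_mul_legTwo_id, ← mul_assoc, ← map_mul, LinearMap.antipode_mul_id, map_one,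
    one_mul]

/-- `S(h₁)₁ h₂ ⊗ S(h₁)₂ = 1 ⊗ S(h)`. -/
theorem comul_antipode_mul_legOne :
    convComul (toConv (HopfAlgebra.antipode k (A := H))) * legOne (toConv LinearMap.id) =
      legTwo (toConv (HopfAlgebra.antipode k)) := by
  have h : convComul (toConv (LinearMap.id : H →ₗ[k] H)) *
      legTwo (toConv (HopfAlgebra.antipode k)) = legOne (toConv LinearMap.id) := by
    rw [← legOne_id_mul_legTwo_id, mul_assoc, ← map_mul, LinearMap.id_mul_antipode, map_one,
      mul_one]
  rw [← h, ← mul_assoc, ← map_mul, LinearMap.antipode_mul_id, map_one, one_mul]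

/-- The map `a ⊗ b ↦ Δ(a) (b ⊗ 1)`. -/
def comulMulLeg : H ⊗[k] H →ₗ[k] H ⊗[k] H :=
  LinearMap.mul' k (H ⊗[k] H) ∘ₗ TensorProduct.map Coalgebra.comul
    (Algebra.TensorProduct.includeLeft : H →ₐ[k] H ⊗[k] H).toLinearMap

theorem comulMulLeg_tmul (a b : H) : comulMulLeg (a ⊗ₜ[k] b) = Coalgebra.comul a * b ⊗ₜ 1 := by
  simp [comulMulLeg]

theorem comulMulLeg_leg_mul (a : H) (r : H ⊗[k] H) :
    comulMulLeg ((a ⊗ₜ[k] 1) * r) = Coalgebra.comul a * comulMulLeg r := by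
  induction r with
  | zero => simp
  | add x y hx hy => simp only [map_add, mul_add, hx, hy]
  | tmul x y => simp [comulMulLeg_tmul, mul_assoc]

theorem comulMulLeg_antipode_comul (h : H) :
    comulMulLeg ((HopfAlgebra.antipode k).rTensor H (Coalgebra.comul h)) =
      1 ⊗ₜ[k] HopfAlgebra.antipode k h := by
  refine Eq.trans ?_ (LinearMap.congr_fun (congrArg ofConv
    (comul_antipode_mul_legOne (k := k) (H := H))) h)
  rw [LinearMap.convMul_apply]
  generalize (Coalgebra.comul h : H ⊗[k] H) = t
  induction t with
  | zero => simp
  | add x y hx hy => simp only [map_add, hx, hy]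
  | tmul x y => simp [comulMulLeg_tmul]

/-- The map `a ⊗ b ↦ (S(a) ⊗ 1) Δ(b)`. -/
def antipodeMulComul : H ⊗[k] H →ₗ[k] H ⊗[k] H :=
  LinearMap.mul' k (H ⊗[k] H) ∘ₗ TensorProduct.map
    ((Algebra.TensorProduct.includeLeft : H →ₐ[k] H ⊗[k] H).toLinearMap ∘ₗ HopfAlgebra.antipode k)
    Coalgebra.comul

theorem antipodeMulComul_tmul (a b : H) : antipodeMulComul (a ⊗ₜ[k] b) =
    (HopfAlgebra.antipode k a ⊗ₜ 1) * Coalgebra.comul b := by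
  simp [antipodeMulComul]

theorem antipodeMulComul_mul_leg (r : H ⊗[k] H) (b : H) :
    antipodeMulComul (r * b ⊗ₜ[k] 1) =
      (HopfAlgebra.antipode k b ⊗ₜ 1) * antipodeMulComul r := by
  induction r with
  | zero => simp
  | add x y hx hy => simp only [map_add, add_mul, mul_add, hx, hy]
  | tmul x y =>
    simp [antipodeMulComul_tmul, HopfAlgebra.antipode_mul_antidistrib, ← mul_assoc]

theorem antipodeMulComul_comul (a : H) :
    antipodeMulComul (Coalgebra.comul a) = 1 ⊗ₜ[k] a := by
  refine Eq.trans ?_ (LinearMap.congr_fun (congrArg ofConv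
    (legOne_antipode_mul_comul (k := k) (H := H))) a)
  rw [LinearMap.convMul_apply]
  generalize (Coalgebra.comul a : H ⊗[k] H) = t
  induction t with
  | zero => simp
  | add x y hx hy => simp only [map_add, hx, hy]
  | tmul x y => simp [antipodeMulComul_tmul]

/-- Applying `a ⊗ b ↦ (S(a) ⊗ 1) Δ(b)` to `a(c₁) ⊗ f(c₂)` gives `S(a(c₁)) f(c₂)₁ ⊗ f(c₂)₂`. -/
theorem convComp_antipodeMulComul_legs (a f : WithConv (D →ₗ[k] H)) :
    convComp antipodeMulComul (legOne a * legTwo f) = legOne (convAntipode a) * convComul f := by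
  ext d
  simp only [convComp, LinearMap.comp_apply, LinearMap.convMul_apply]
  generalize (Coalgebra.comul d : D ⊗[k] D) = t
  induction t with
  | zero => simp
  | add x y hx hy => simp only [map_add, hx, hy]
  | tmul x y => simp [antipodeMulComul_tmul]

/-- Applying `a ⊗ b ↦ (S(a) ⊗ 1) Δ(b)` to `f(c₁)₁ a(c₂) ⊗ f(c₁)₂` gives `S(a(c₂)) ⊗ f(c₁)`: the
first leg of `Δ(f(c₁))` is cancelled by its antipode. -/
theorem convComp_antipodeMulComul_comul_mul_leg (f a : WithConv (D →ₗ[k] H)) :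
    convComp antipodeMulComul (convComul f * legOne a) = legTwo f * legOne (convAntipode a) := by
  ext d
  simp only [convComp, LinearMap.comp_apply, LinearMap.convMul_apply]
  generalize (Coalgebra.comul d : D ⊗[k] D) = t
  induction t with
  | zero => simp
  | add x y hx hy => simp only [map_add, hx, hy]
  | tmul x y => simp [antipodeMulComul_mul_leg, antipodeMulComul_comul]

end Hopf

/-! ### Partial corepresentations and equivariant maps -/

section Corep

variable {k H D : Type*} [Field k] [Ring H] [HopfAlgebra k H]
  [AddCommGroup D] [Module k D] [Coalgebra k D] {ω : D →ₗ[k] H}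

theorem toConv_idempotentMap (ω : D →ₗ[k] H) :
    toConv (idempotentMap ω) = toConv ω * convAntipode (toConv ω) := rfl

namespace IsPartialCorep

/-- The second axiom of a partial corepresentation, in the convolution algebra `Hom(D, H ⊗ H)`. -/
theorem convComul_mul_legTwo_antipode (hω : IsPartialCorep ω) :
    convComul (toConv ω) * legTwo (convAntipode (toConv ω)) =
      legOne (toConv ω) * legTwo (toConv (idempotentMap ω)) := by
  ext d
  have h := LinearMap.congr_fun hω.comul_left d
  refine Eq.trans ?_ (h.trans ?_)
  all_goals
    simp only [LinearMap.comp_apply, LinearMap.convMul_apply]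
    generalize (Coalgebra.comul d : D ⊗[k] D) = t
    induction t with
    | zero => simp
    | add x y hx hy => simp only [map_add, hx, hy]
    | tmul x y => ?_
  · simp only [TensorProduct.map_tmul, LinearMap.comp_apply, LinearMap.mul'_apply, convPost_apply,
      convComp, Bialgebra.comulAlgHom_apply, Algebra.TensorProduct.includeRight_apply]
    generalize (Coalgebra.comul (ω x) : H ⊗[k] H) = s
    induction s with
    | zero => simp
    | add x y hx hy => simp only [map_add, add_mul, TensorProduct.add_tmul, hx, hy]
    | tmul x y => simp
  · simp

/-- The third axiom of a partial corepresentation, in the convolution algebra `Hom(D, H ⊗ H)`. -/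
theorem legOne_mul_antipode_comul (hω : IsPartialCorep ω) :
    legOne (toConv ω) *
        toConv ((HopfAlgebra.antipode k).rTensor H ∘ₗ Coalgebra.comul ∘ₗ ω) =
      legOne (toConv (idempotentMap ω)) * legTwo (toConv ω) := by
  ext d
  have h := LinearMap.congr_fun hω.comul_right d
  refine Eq.trans ?_ (h.trans ?_)
  all_goals
    simp only [LinearMap.comp_apply, LinearMap.convMul_apply]
    generalize (Coalgebra.comul d : D ⊗[k] D) = t
    induction t with
    | zero => simp
    | add x y hx hy => simp only [map_add, hx, hy]
    | tmul x y => ?_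
  · simp only [TensorProduct.map_tmul, LinearMap.comp_apply, LinearMap.mul'_apply, convPost_apply,
      Algebra.TensorProduct.includeLeft_apply]
    generalize (Coalgebra.comul (ω y) : H ⊗[k] H) = s
    induction s with
    | zero => simp
    | add x y hx hy => simp only [map_add, mul_add, TensorProduct.tmul_add, hx, hy]
    | tmul x y => simp
  · simp

/-- `ω(c₁) S(ω(c₂)) ω(c₃) = ω(c)`. -/
theorem idempotentMap_mul (hω : IsPartialCorep ω) :
    toConv (idempotentMap ω) * toConv ω = toConv ω := by
  have h := congrArg (convComp (LinearMap.mul' k H)) hω.legOne_mul_antipode_comul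
  have hT : ∀ (a : H) (r : H ⊗[k] H), LinearMap.mul' k H
      ((Algebra.TensorProduct.includeLeft : H →ₐ[k] H ⊗[k] H) a * r) =
        AlgHom.id k H a * LinearMap.mul' k H r := by
    intro a r
    induction r with
    | zero => simp
    | add x y hx hy => simp only [map_add, mul_add, hx, hy]
    | tmul x y => simp [mul_assoc]
  -- The left side `S(ω(c)₁) ω(c)₂` is `ε(ω(c)) = ε(c)`.
  have h1 : convComp (LinearMap.mul' k H) (toConv
      ((HopfAlgebra.antipode k).rTensor H ∘ₗ Coalgebra.comul ∘ₗ ω)) = 1 := by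
    ext d
    simp [convComp, ← LinearMap.congr_fun hω.counit_comp d]
  rw [convComp_convPost_mul hT, convComp_convPost_mul hT, h1, mul_one,
    convComp_convPost (Ψ := AlgHom.id k H) (by simp)] at h
  exact h.symm

end IsPartialCorep

/-- A linear map `f : D → H` is `ω`-equivariant if
`ω(c₁) ⊗ f(c₂) = f(c₁)₁ ω(c₂) ⊗ f(c₁)₂`. -/
def IsEquivariant (ω : D →ₗ[k] H) (f : WithConv (D →ₗ[k] H)) : Prop :=
  legOne (toConv ω) * legTwo f = convComul f * legOne (toConv ω)

namespace IsEquivariant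

variable {f g : WithConv (D →ₗ[k] H)}

theorem algebraMap (ω : D →ₗ[k] H) (r : k) :
    IsEquivariant ω (algebraMap k (WithConv (D →ₗ[k] H)) r) := by
  rw [IsEquivariant, AlgHom.commutes, AlgHom.commutes, Algebra.commutes]

theorem add (hf : IsEquivariant ω f) (hg : IsEquivariant ω g) : IsEquivariant ω (f + g) := by
  unfold IsEquivariant at *
  rw [map_add, map_add, mul_add, add_mul, hf, hg]

theorem mul (hf : IsEquivariant ω f) (hg : IsEquivariant ω g) : IsEquivariant ω (f * g) := by
  unfold IsEquivariant at *
  rw [map_mul, map_mul, ← mul_assoc, hf, mul_assoc, hg, mul_assoc]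

/-- The right-hand form of the twisted coaction on an equivariant map:
`ω(c₁) S(ω(c₃)) ⊗ f(c₂) = f(c₁)₁ E(c₂) ⊗ f(c₁)₂`. -/
theorem conj_eq_comul_mul (hf : IsEquivariant ω f) :
    legOne (toConv ω) * legTwo f * legOne (convAntipode (toConv ω)) =
      convComul f * legOne (toConv (idempotentMap ω)) := by
  rw [hf, toConv_idempotentMap, map_mul, mul_assoc]

/-- The left-hand form of the twisted coaction on an equivariant map:
`ω(c₁) S(ω(c₃)) ⊗ f(c₂) = E(c₁) f(c₂)₁ ⊗ f(c₂)₂`. -/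
theorem conj_eq_mul_comul (hf : IsEquivariant ω f) :
    legOne (toConv ω) * legTwo f * legOne (convAntipode (toConv ω)) =
      legOne (toConv (idempotentMap ω)) * convComul f := by
  have h := congrArg (convComp antipodeMulComul) hf
  rw [convComp_antipodeMulComul_legs, convComp_antipodeMulComul_comul_mul_leg] at h
  rw [toConv_idempotentMap, map_mul, mul_assoc, mul_assoc, h]

end IsEquivariant

/-- The map `h ↦ h₁ ξ(h₂)` for a linear functional `ξ`. -/
def contractRight (ξ : Module.Dual k H) : H →ₗ[k] H :=
  (TensorProduct.rid k H).toLinearMap ∘ₗ ξ.lTensor H ∘ₗ Coalgebra.comul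

theorem lTensor_contractRight_comul (ξ : Module.Dual k H) (a : H) :
    (contractRight ξ).lTensor H (Coalgebra.comul a) = Coalgebra.comul (contractRight ξ a) := by
  have h1 : ∀ t : H ⊗[k] H, (contractRight ξ).lTensor H t =
      (TensorProduct.rid k (H ⊗[k] H)).toLinearMap (ξ.lTensor (H ⊗[k] H)
        ((TensorProduct.assoc k H H H).symm (Coalgebra.comul.lTensor H t))) := by
    intro t
    induction t with
    | zero => simp
    | add x y hx hy => simp only [map_add, hx, hy]
    | tmul x y =>
      simp only [LinearMap.lTensor_tmul, contractRight, LinearMap.comp_apply]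
      generalize (Coalgebra.comul y : H ⊗[k] H) = s
      induction s with
      | zero => simp
      | add x y hx hy => simp only [map_add, TensorProduct.tmul_add, hx, hy]
      | tmul x y => simp
  rw [h1, ← Coalgebra.coassoc_apply, LinearEquiv.symm_apply_apply]
  simp only [contractRight, LinearMap.comp_apply]
  generalize (Coalgebra.comul a : H ⊗[k] H) = s
  induction s with
  | zero => simp
  | add x y hx hy => simp only [map_add, hx, hy]
  | tmul x y => simp

/-- Equivariance is inherited by `d ↦ f(d)₁ ξ(f(d)₂)`, by coassociativity. -/
theorem IsEquivariant.contractRight (ξ : Module.Dual k H) {f : WithConv (D →ₗ[k] H)}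
    (hf : IsEquivariant ω f) : IsEquivariant ω (convComp (contractRight ξ) f) := by
  have h := congrArg (convComp ((PartialHopf.contractRight ξ).lTensor H)) hf
  have hl : ∀ (a : H) (r : H ⊗[k] H), (PartialHopf.contractRight ξ).lTensor H
      ((Algebra.TensorProduct.includeLeft : H →ₐ[k] H ⊗[k] H) a * r) =
        (Algebra.TensorProduct.includeLeft : H →ₐ[k] H ⊗[k] H) a *
          (PartialHopf.contractRight ξ).lTensor H r := by
    intro a r
    induction r with
    | zero => simp
    | add x y hx hy => simp only [map_add, mul_add, hx, hy]
    | tmul x y => simp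
  have hr : ∀ (r : H ⊗[k] H) (a : H), (PartialHopf.contractRight ξ).lTensor H
      (r * (Algebra.TensorProduct.includeLeft : H →ₐ[k] H ⊗[k] H) a) =
          (PartialHopf.contractRight ξ).lTensor H r *
            (Algebra.TensorProduct.includeLeft : H →ₐ[k] H ⊗[k] H) a := by
    intro r a
    induction r with
    | zero => simp
    | add x y hx hy => simp only [map_add, add_mul, hx, hy]
    | tmul x y => simp
  rw [convComp_convPost_mul hl, convComp_mul_convPost hr] at h
  refine h.trans (congrArg (· * _) ?_)
  ext d
  exact lTensor_contractRight_comul ξ _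

/-- `ω(c₁) ξ(f(c₂)) = f(c₁)₁ ξ(f(c₁)₂) ω(c₂)` for an equivariant map `f`. -/
theorem IsEquivariant.mul_comp (ξ : Module.Dual k H) {f : WithConv (D →ₗ[k] H)}
    (hf : IsEquivariant ω f) :
    toConv ω * convPost (Algebra.ofId k H) (convComp ξ f) =
      convComp (PartialHopf.contractRight ξ) f * toConv ω := by
  let T : H ⊗[k] H →ₗ[k] H := (TensorProduct.rid k H).toLinearMap ∘ₗ ξ.lTensor H
  have h := congrArg (convComp T) hf
  have hl : ∀ (a : H) (r : H ⊗[k] H),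
      T ((Algebra.TensorProduct.includeLeft : H →ₐ[k] H ⊗[k] H) a * r) =
        AlgHom.id k H a * T r := by
    intro a r
    induction r with
    | zero => simp
    | add x y hx hy => simp only [map_add, mul_add, hx, hy]
    | tmul x y => simp [T]
  have hr : ∀ (r : H ⊗[k] H) (a : H),
      T (r * (Algebra.TensorProduct.includeLeft : H →ₐ[k] H ⊗[k] H) a) =
        T r * AlgHom.id k H a := by
    intro r a
    induction r with
    | zero => simp
    | add x y hx hy => simp only [map_add, add_mul, hx, hy]
    | tmul x y => simp [T]
  rw [convComp_convPost_mul hl, convComp_mul_convPost hr] at h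
  refine Eq.trans (congrArg (toConv ω * ·) ?_) h
  ext d
  simp [convComp, T, Algebra.ofId_apply, Algebra.algebraMap_eq_smul_one]

/-- The idempotent map `E` of a partial corepresentation is equivariant:
`ω(c₁) ⊗ E(c₂) = E(c₁)₁ ω(c₂) ⊗ E(c₁)₂`. -/
theorem IsPartialCorep.isEquivariant_idempotentMap (hω : IsPartialCorep ω) :
    IsEquivariant ω (toConv (idempotentMap ω)) := by
  have hT : ∀ (a : H) (r : H ⊗[k] H), comulMulLeg
      ((Algebra.TensorProduct.includeLeft : H →ₐ[k] H ⊗[k] H) a * r) =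
        Bialgebra.comulAlgHom k H a * comulMulLeg r := fun a r => comulMulLeg_leg_mul a r
  -- Applying `a ⊗ b ↦ Δ(a) (b ⊗ 1)` to the third axiom turns its left side into that of the second.
  have h := congrArg (convComp comulMulLeg) hω.legOne_mul_antipode_comul
  have h1 : convComp comulMulLeg
      (toConv ((HopfAlgebra.antipode k).rTensor H ∘ₗ Coalgebra.comul ∘ₗ ω)) =
        legTwo (convAntipode (toConv ω)) := by
    ext d
    exact comulMulLeg_antipode_comul _
  rw [convComp_convPost_mul hT, convComp_convPost_mul hT, h1,
    convComp_convPost (Ψ := Algebra.TensorProduct.includeLeft)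
      (by simp [comulMulLeg_tmul])] at h
  exact hω.convComul_mul_legTwo_antipode.symm.trans h

end Corep

/-! ### Slices of tensors -/

section Slice

variable {k V W M N : Type*} [Field k] [AddCommGroup V] [Module k V] [AddCommGroup W] [Module k W]
  [AddCommGroup M] [Module k M] [AddCommGroup N] [Module k N]

/-- If the linear maps `φ i` jointly separate the points of `M`, then the maps `id ⊗ φ i` jointly
separate the points of `V ⊗ M`. -/
theorem eq_of_lTensor_eq {ι : Sort*} (φ : ι → M →ₗ[k] N) (hφ : ∀ m, (∀ i, φ i m = 0) → m = 0)
    {s t : V ⊗[k] M} (h : ∀ i, (φ i).lTensor V s = (φ i).lTensor V t) : s = t := by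
  rw [← sub_eq_zero]
  replace h : ∀ i, (φ i).lTensor V (s - t) = 0 := fun i => by rw [map_sub, h, sub_self]
  generalize s - t = r at h
  let b := Module.Free.chooseBasis k V
  have key : ∀ i j, TensorProduct.equivFinsuppOfBasisLeft b ((φ i).lTensor V r) j =
      φ i (TensorProduct.equivFinsuppOfBasisLeft b r j) := by
    intro i j
    clear h
    induction r with
    | zero => simp
    | add x y hx hy => simp [hx, hy]
    | tmul x y => simp
  apply (TensorProduct.equivFinsuppOfBasisLeft b).injective
  ext j
  simpa using hφ _ fun i => by rw [← key, h]; simp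

/-- The map `v ⊗ m ↦ φ(m) v` for a linear functional `φ`. -/
def slice (V : Type*) [AddCommGroup V] [Module k V] (φ : M →ₗ[k] k) : V ⊗[k] M →ₗ[k] V :=
  (TensorProduct.rid k V).toLinearMap ∘ₗ φ.lTensor V

@[simp]
theorem slice_tmul (φ : M →ₗ[k] k) (v : V) (m : M) : slice V φ (v ⊗ₜ m) = φ m • v := by
  simp [slice]

theorem eq_of_slice_eq {ι : Sort*} (φ : ι → M →ₗ[k] k) (hφ : ∀ m, (∀ i, φ i m = 0) → m = 0)
    {s t : V ⊗[k] M} (h : ∀ i, slice V (φ i) s = slice V (φ i) t) : s = t :=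
  eq_of_lTensor_eq φ hφ fun i => (TensorProduct.rid k V).injective (h i)

end Slice

section SliceBialgebra

variable {k H B : Type*} [Field k] [Ring H] [Bialgebra k H] [AddCommGroup B] [Module k B]

theorem lTensor_slice_comulCoaction (lam : B →ₗ[k] H ⊗[k] B) (φ : B →ₗ[k] k) (b : B) :
    (slice H φ).lTensor H (comulCoaction lam b) = Coalgebra.comul (slice H φ (lam b)) := by
  simp only [comulCoaction, LinearMap.comp_apply]
  generalize lam b = t
  induction t with
  | zero => simp
  | add x y hx hy => simp only [map_add, hx, hy]
  | tmul x y =>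
    simp only [LinearMap.rTensor_tmul, slice_tmul, map_smul]
    generalize (Coalgebra.comul x : H ⊗[k] H) = s
    induction s with
    | zero => simp
    | add x y hx hy => simp only [map_add, smul_add, TensorProduct.add_tmul, hx, hy]
    | tmul u v => simp

theorem lTensor_slice_mulLeftTensor (φ : B →ₗ[k] k) (h : H) (x : H ⊗[k] (H ⊗[k] B)) :
    (slice H φ).lTensor H (mulLeftTensor k H (H ⊗[k] B) (h ⊗ₜ x)) =
      (h ⊗ₜ 1) * (slice H φ).lTensor H x := by
  induction x with
  | zero => simp
  | add x y hx hy => simp only [map_add, mul_add, TensorProduct.tmul_add, hx, hy]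
  | tmul x y => simp [mulLeftTensor]

theorem lTensor_slice_mulRightTensor (φ : B →ₗ[k] k) (h : H) (x : H ⊗[k] (H ⊗[k] B)) :
    (slice H φ).lTensor H (mulRightTensor k H (H ⊗[k] B) (x ⊗ₜ h)) =
      (slice H φ).lTensor H x * (h ⊗ₜ 1) := by
  induction x with
  | zero => simp
  | add x y hx hy => simp only [map_add, add_mul, TensorProduct.add_tmul, hx, hy]
  | tmul x y => simp [mulRightTensor]

/-- Slicing `g h ⊗ (b ⊗ c)` at a product functional is multiplicative in `g ⊗ b` and `h ⊗ c`. -/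
theorem slice_tensorTensorTensorComm (φ ψ : B →ₗ[k] k) (x y : H ⊗[k] B) :
    slice H (LinearMap.mul' k k ∘ₗ TensorProduct.map φ ψ)
      ((LinearMap.mul' k H).rTensor (B ⊗[k] B)
        (TensorProduct.tensorTensorTensorComm k H B H B (x ⊗ₜ y))) =
      slice H φ x * slice H ψ y := by
  induction x with
  | zero => simp
  | add x x' hx hx' => simp only [map_add, add_mul, TensorProduct.add_tmul, hx, hx']
  | tmul h b =>
    induction y with
    | zero => simp
    | add x y hx hy => simp only [map_add, mul_add, TensorProduct.tmul_add, hx, hy]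
    | tmul h' b' => simp [mul_smul]; rw [smul_comm]

end SliceBialgebra

section TwistedMap

variable {k H D B : Type*} [Field k] [Ring H] [HopfAlgebra k H]
  [AddCommGroup D] [Module k D] [Coalgebra k D] [AddCommGroup B] [Module k B]

/-- The map `d ↦ ω(d₁) S(ω(d₃)) ⊗ π(d₂)`. -/
def twistedMap (ω : D →ₗ[k] H) (π : D →ₗ[k] B) : D →ₗ[k] H ⊗[k] B :=
  mulRightTensor k H B ∘ₗ
    TensorProduct.map (TensorProduct.map ω π ∘ₗ Coalgebra.comul)
      (HopfAlgebra.antipode k ∘ₗ ω) ∘ₗ Coalgebra.comul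

/-- A map `h ⊗ b ↦ Φ(h) F(b)` with commuting values turns the twisted map into the threefold
convolution product `d ↦ Φ(ω(d₁)) F(π(d₂)) Φ(S(ω(d₃)))`. -/
theorem apply_twistedMap {R : Type*} [Ring R] [Algebra k R] (Φ : H →ₐ[k] R) (F : B →ₗ[k] R)
    (T : H ⊗[k] B →ₗ[k] R) (hT : ∀ h b, T (h ⊗ₜ b) = Φ h * F b) (hc : ∀ h b, Commute (Φ h) (F b))
    (ω : D →ₗ[k] H) (π : D →ₗ[k] B) (d : D) :
    T (twistedMap ω π d) = (convPost Φ (toConv ω) * toConv (F ∘ₗ π) *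
      convPost Φ (convAntipode (toConv ω))).ofConv d := by
  simp only [twistedMap, LinearMap.comp_apply, LinearMap.convMul_apply]
  generalize (Coalgebra.comul d : D ⊗[k] D) = t
  induction t with
  | zero => simp
  | add x y hx hy => simp only [map_add, hx, hy]
  | tmul x y =>
    simp only [TensorProduct.map_tmul, LinearMap.comp_apply, LinearMap.mul'_apply,
      LinearMap.convMul_apply]
    generalize (Coalgebra.comul x : D ⊗[k] D) = s
    induction s with
    | zero => simp
    | add x y hx hy => simp only [map_add, TensorProduct.add_tmul, add_mul, hx, hy]
    | tmul u v =>
      simp only [mulRightTensor, TensorProduct.map_tmul, LinearMap.comp_apply,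
        LinearEquiv.coe_coe, TensorProduct.rightComm_tmul, LinearMap.rTensor_tmul,
        LinearMap.mul'_apply, hT, map_mul, convPost_apply, convComp]
      rw [mul_assoc, mul_assoc, (hc _ _).eq]

theorem slice_twistedMap (φ : B →ₗ[k] k) (ω : D →ₗ[k] H) (π : D →ₗ[k] B) (d : D) :
    slice H φ (twistedMap ω π d) = (toConv ω * convPost (Algebra.ofId k H) (toConv (φ ∘ₗ π)) *
      convAntipode (toConv ω)).ofConv d :=
  apply_twistedMap (AlgHom.id k H) ((Algebra.ofId k H).toLinearMap ∘ₗ φ) _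
    (fun h b => by simp [Algebra.ofId_apply, Algebra.smul_def, Algebra.commutes])
    (fun h b => (Algebra.commutes (φ b) h).symm) ω π d

theorem lTensor_twistedMap (F : B →ₗ[k] H) (ω : D →ₗ[k] H) (π : D →ₗ[k] B) (d : D) :
    F.lTensor H (twistedMap ω π d) = (legOne (toConv ω) * legTwo (toConv (F ∘ₗ π)) *
      legOne (convAntipode (toConv ω))).ofConv d :=
  apply_twistedMap Algebra.TensorProduct.includeLeft
    ((Algebra.TensorProduct.includeRight : H →ₐ[k] H ⊗[k] H).toLinearMap ∘ₗ F) _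
    (fun h b => by simp) (fun h b => by simp [Commute, SemiconjBy]) ω π d

end TwistedMap

/-! ### Descent of the twisted coaction -/

section Descent

variable {k H D B : Type*} [Field k] [Ring H] [HopfAlgebra k H]
  [AddCommGroup D] [Module k D] [Coalgebra k D] [AddCommGroup B] [Module k B] [Coalgebra k B]

/-- The algebra map `T(H*) → Hom(B, H)` (convolution product) extending
`ξ ↦ (b ↦ p(b)₁ ξ(p(b)₂))`. -/
def contractLift (p : B →ₗ[k] H) :
    TensorAlgebra k (Module.Dual k H) →ₐ[k] WithConv (B →ₗ[k] H) :=
  TensorAlgebra.lift k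
    { toFun := fun ξ => convComp (contractRight ξ) (toConv p)
      map_add' := fun ξ η => by
        ext b
        simp [convComp, contractRight, LinearMap.lTensor_add]
      map_smul' := fun r ξ => by
        ext b
        simp [convComp, contractRight, LinearMap.lTensor_smul] }

theorem contractLift_ι (p : B →ₗ[k] H) (ξ : Module.Dual k H) :
    contractLift p (TensorAlgebra.ι k ξ) = convComp (contractRight ξ) (toConv p) := by
  simp [contractLift]

theorem cofreeLiftAlg_ι (p : B →ₗ[k] H) (ξ : Module.Dual k H) :
    cofreeLiftAlg p (TensorAlgebra.ι k ξ) = convComp ξ (toConv p) := by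
  simp only [cofreeLiftAlg, TensorAlgebra.lift_ι_apply]
  rfl

/-- The slice at the word `w ∈ T(H*)` of the coaction to be constructed on `B`. -/
def coactionSlice (p : B →ₗ[k] H) (w : TensorAlgebra k (Module.Dual k H)) :
    WithConv (B →ₗ[k] H) :=
  contractLift p w * toConv p

variable {ω : D →ₗ[k] H} {π : D →ₗc[k] B} {p : B →ₗ[k] H}

theorem isEquivariant_contractLift (hω : IsPartialCorep ω)
    (hp : convPre π (toConv p) = toConv (idempotentMap ω))
    (w : TensorAlgebra k (Module.Dual k H)) :
    IsEquivariant ω (convPre π (contractLift p w)) := by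
  induction w using TensorAlgebra.induction with
  | algebraMap r =>
    rw [AlgHom.commutes, AlgHom.commutes]
    exact .algebraMap ω r
  | ι ξ =>
    rw [contractLift_ι]
    have h := hω.isEquivariant_idempotentMap
    rw [← hp] at h
    exact h.contractRight ξ
  | add a b ha hb => rw [map_add, map_add]; exact ha.add hb
  | mul a b ha hb => rw [map_mul, map_mul]; exact ha.mul hb

/-- A word `w` in functionals `ξ ∘ E` can be moved past `ω` at the cost of replacing it by the map
`contractLift p w`, which factors through `π`. -/
theorem mul_convPre_cofreeLiftAlg (hω : IsPartialCorep ω)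
    (hp : convPre π (toConv p) = toConv (idempotentMap ω))
    (w : TensorAlgebra k (Module.Dual k H)) :
    toConv ω * convPost (Algebra.ofId k H) (convPre π (cofreeLiftAlg p w)) =
      convPre π (contractLift p w) * toConv ω := by
  induction w using TensorAlgebra.induction with
  | algebraMap r => simp only [AlgHom.commutes, Algebra.commutes]
  | ι ξ =>
    rw [contractLift_ι, cofreeLiftAlg_ι]
    have h := hω.isEquivariant_idempotentMap
    rw [← hp] at h
    exact h.mul_comp ξ
  | add a b ha hb => simp only [map_add, mul_add, add_mul, ha, hb]
  | mul a b ha hb =>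
    simp only [map_mul]
    rw [← mul_assoc, ha, mul_assoc, hb, mul_assoc]

/-- `f_w(π(d)) = ω(d₁) w(π(d₂)) S(ω(d₃))` for the slice `f_w` at the word `w`. -/
theorem convPre_coactionSlice (hω : IsPartialCorep ω)
    (hp : convPre π (toConv p) = toConv (idempotentMap ω))
    (w : TensorAlgebra k (Module.Dual k H)) :
    convPre π (coactionSlice p w) = toConv ω *
      convPost (Algebra.ofId k H) (convPre π (cofreeLiftAlg p w)) * convAntipode (toConv ω) := by
  rw [mul_convPre_cofreeLiftAlg hω hp, coactionSlice, map_mul, hp, toConv_idempotentMap, mul_assoc]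

theorem isEquivariant_coactionSlice (hω : IsPartialCorep ω)
    (hp : convPre π (toConv p) = toConv (idempotentMap ω))
    (w : TensorAlgebra k (Module.Dual k H)) :
    IsEquivariant ω (convPre π (coactionSlice p w)) := by
  rw [coactionSlice, map_mul, hp]
  exact (isEquivariant_contractLift hω hp w).mul hω.isEquivariant_idempotentMap

/-- The map `p` acts on slices as a left identity, because `E * ω = ω`. -/
theorem mul_coactionSlice (hω : IsPartialCorep ω) (hπ : Function.Surjective π)
    (hp : convPre π (toConv p) = toConv (idempotentMap ω))
    (w : TensorAlgebra k (Module.Dual k H)) :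
    toConv p * coactionSlice p w = coactionSlice p w := by
  apply convPre_injective hπ
  rw [map_mul, hp, convPre_coactionSlice hω hp, ← mul_assoc, ← mul_assoc, hω.idempotentMap_mul]

/-- Slices are multiplicative in the word. -/
theorem coactionSlice_mul (hω : IsPartialCorep ω) (hπ : Function.Surjective π)
    (hp : convPre π (toConv p) = toConv (idempotentMap ω))
    (w w' : TensorAlgebra k (Module.Dual k H)) :
    coactionSlice p (w * w') = coactionSlice p w * coactionSlice p w' := by
  conv_rhs => rw [coactionSlice, mul_assoc, mul_coactionSlice hω hπ hp]
  rw [coactionSlice, coactionSlice, map_mul, mul_assoc]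

/-- The slice at `w` of the iterated coaction agrees with that of the left-hand coassociativity
expression. -/
theorem conj_coactionSlice_eq_mul_comul (hω : IsPartialCorep ω)
    (hp : convPre π (toConv p) = toConv (idempotentMap ω))
    (w : TensorAlgebra k (Module.Dual k H)) :
    legOne (toConv ω) * legTwo (convPre π (coactionSlice p w)) *
      legOne (convAntipode (toConv ω)) =
        convPre π (legOne (toConv p) * convComul (coactionSlice p w)) := by
  rw [(isEquivariant_coactionSlice hω hp w).conj_eq_mul_comul, map_mul, ← hp]
  rfl

/-- The slice at `w` of the iterated coaction agrees with that of the right-hand coassociativity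
expression. -/
theorem conj_coactionSlice_eq_comul_mul (hω : IsPartialCorep ω)
    (hp : convPre π (toConv p) = toConv (idempotentMap ω))
    (w : TensorAlgebra k (Module.Dual k H)) :
    legOne (toConv ω) * legTwo (convPre π (coactionSlice p w)) *
      legOne (convAntipode (toConv ω)) =
        convPre π (convComul (coactionSlice p w) * legOne (toConv p)) := by
  rw [(isEquivariant_coactionSlice hω hp w).conj_eq_comul_mul, map_mul, ← hp]
  rfl

theorem counit_coactionSlice (hω : IsPartialCorep ω) (hπ : Function.Surjective π)
    (hp : convPre π (toConv p) = toConv (idempotentMap ω))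
    (w : TensorAlgebra k (Module.Dual k H)) :
    convPost (Bialgebra.counitAlgHom k H) (coactionSlice p w) = cofreeLiftAlg p w := by
  apply convPre_injective hπ
  have h1 : convPost (Bialgebra.counitAlgHom k H) (toConv ω) = 1 := by
    ext d
    exact LinearMap.congr_fun hω.counit_comp d
  have h2 : convPost (Bialgebra.counitAlgHom k H) (convAntipode (toConv ω)) = 1 := by
    rw [← h1]
    ext d
    simp [convComp]
  rw [convPre_convPost, convPre_coactionSlice hω hp, map_mul, map_mul, h1, h2, one_mul, mul_one]
  ext d
  simp [Algebra.ofId_apply]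

/-- The words in the functionals `ξ ∘ p` separate the points of `B`. -/
theorem eq_zero_of_cofreeLiftAlg (hinj : Function.Injective (cofreeLift p)) (b : B)
    (hb : ∀ w, (cofreeLiftAlg p w).ofConv b = 0) : b = 0 := by
  apply hinj
  rw [map_zero]
  exact Subtype.ext (LinearMap.ext hb)

/-- The twisted map vanishes on the kernel of `π`, so that it descends to `B`. -/
theorem exists_comp_eq_twistedMap (hω : IsPartialCorep ω) (hπ : Function.Surjective π)
    (hp : convPre π (toConv p) = toConv (idempotentMap ω))
    (hinj : Function.Injective (cofreeLift p)) :
    ∃ lam : B →ₗ[k] H ⊗[k] B, ∀ d, lam (π d) = twistedMap ω π.toLinearMap d := by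
  have hs : ∀ w d, slice H (cofreeLiftAlg p w).ofConv (twistedMap ω π.toLinearMap d) =
      (coactionSlice p w).ofConv (π d) := by
    intro w d
    rw [slice_twistedMap]
    exact (LinearMap.congr_fun (congrArg ofConv (convPre_coactionSlice hω hp w)) d).symm
  -- By `hs` every slice of the twisted map depends on `π d` only, so composing with any linear
  -- section of `π` gives a map with the required property.
  obtain ⟨σ, hσ⟩ := π.toLinearMap.exists_rightInverse_of_surjective
    (LinearMap.range_eq_top.2 hπ)
  refine ⟨twistedMap ω π.toLinearMap ∘ₗ σ, fun d => ?_⟩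
  refine eq_of_slice_eq (fun w => (cofreeLiftAlg p w).ofConv) (eq_zero_of_cofreeLiftAlg hinj)
    fun w => ?_
  rw [LinearMap.comp_apply, hs, hs]
  exact congrArg _ (LinearMap.congr_fun hσ (π d))

section Coaction

variable {lam : B →ₗ[k] H ⊗[k] B}

theorem slice_coaction (hω : IsPartialCorep ω) (hπ : Function.Surjective π)
    (hp : convPre π (toConv p) = toConv (idempotentMap ω))
    (hlam : ∀ d, lam (π d) = twistedMap ω π.toLinearMap d)
    (w : TensorAlgebra k (Module.Dual k H)) (b : B) :
    slice H (cofreeLiftAlg p w).ofConv (lam b) = (coactionSlice p w).ofConv b := by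
  obtain ⟨d, rfl⟩ := hπ b
  rw [hlam, slice_twistedMap]
  exact (LinearMap.congr_fun (congrArg ofConv (convPre_coactionSlice hω hp w)) d).symm

theorem coactionNabla_eq (hω : IsPartialCorep ω) (hπ : Function.Surjective π)
    (hp : convPre π (toConv p) = toConv (idempotentMap ω))
    (hlam : ∀ d, lam (π d) = twistedMap ω π.toLinearMap d) : coactionNabla lam = p := by
  ext b
  have h := slice_coaction hω hπ hp hlam 1 b
  rw [coactionSlice, map_one, map_one, one_mul] at h
  exact h

theorem lTensor_slice_coaction (hω : IsPartialCorep ω) (hπ : Function.Surjective π)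
    (hp : convPre π (toConv p) = toConv (idempotentMap ω))
    (hlam : ∀ d, lam (π d) = twistedMap ω π.toLinearMap d)
    (w : TensorAlgebra k (Module.Dual k H)) (d : D) :
    (slice H (cofreeLiftAlg p w).ofConv).lTensor H (lam.lTensor H (lam (π d))) =
      (legOne (toConv ω) * legTwo (convPre π (coactionSlice p w)) *
        legOne (convAntipode (toConv ω))).ofConv d := by
  have h : slice H (cofreeLiftAlg p w).ofConv ∘ₗ lam = (coactionSlice p w).ofConv :=
    LinearMap.ext (slice_coaction hω hπ hp hlam w)
  rw [← LinearMap.comp_apply, ← LinearMap.lTensor_comp, h, hlam, lTensor_twistedMap]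
  rfl

theorem isSymmetricPartialCoaction_of_twistedMap (hω : IsPartialCorep ω)
    (hπ : Function.Surjective π) (hp : convPre π (toConv p) = toConv (idempotentMap ω))
    (hinj : Function.Injective (cofreeLift p))
    (hlam : ∀ d, lam (π d) = twistedMap ω π.toLinearMap d) :
    IsSymmetricPartialCoaction lam := by
  have hsep := eq_zero_of_cofreeLiftAlg hinj
  have hslice := slice_coaction hω hπ hp hlam
  have hsep2 : ∀ x : H ⊗[k] B, (∀ w, slice H (cofreeLiftAlg p w).ofConv x = 0) → x = 0 :=
    fun x hx => eq_of_slice_eq (fun w => (cofreeLiftAlg p w).ofConv) hsep fun w => by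
      rw [hx, map_zero]
  constructor
  · ext1 b
    -- Both sides are tested on pairs of words; the left one then becomes the slice at their product.
    refine eq_of_slice_eq (fun w : TensorAlgebra k (Module.Dual k H) ×
      TensorAlgebra k (Module.Dual k H) => LinearMap.mul' k k ∘ₗ
        TensorProduct.map (cofreeLiftAlg p w.1).ofConv (cofreeLiftAlg p w.2).ofConv) ?_ ?_
    · intro t ht
      refine eq_of_slice_eq (fun w => (cofreeLiftAlg p w).ofConv) hsep fun w' => ?_
      rw [map_zero]
      refine hsep _ fun w => ?_
      refine Eq.trans ?_ (ht (w, w'))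
      clear ht
      induction t with
      | zero => simp
      | add x y hx hy => simp only [map_add, hx, hy]
      | tmul x y => simp [mul_comm]
    · rintro ⟨w, w'⟩
      have h1 : ∀ x : H ⊗[k] B, slice H (LinearMap.mul' k k ∘ₗ
          TensorProduct.map (cofreeLiftAlg p w).ofConv (cofreeLiftAlg p w').ofConv)
            (Coalgebra.comul.lTensor H x) = slice H (cofreeLiftAlg p (w * w')).ofConv x := by
        intro x
        rw [map_mul]
        induction x with
        | zero => simp
        | add x y hx hy => simp only [map_add, hx, hy]
        | tmul x y => simp
      simp only [LinearMap.comp_apply (f := Coalgebra.comul.lTensor H)]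
      rw [h1, hslice, coactionSlice_mul hω hπ hp, LinearMap.convMul_apply]
      simp only [LinearMap.comp_apply, LinearEquiv.coe_coe]
      generalize (Coalgebra.comul b : B ⊗[k] B) = t
      induction t with
      | zero => simp
      | add x y hx hy => simp only [map_add, hx, hy]
      | tmul x y =>
        rw [TensorProduct.map_tmul, TensorProduct.map_tmul, slice_tensorTensorTensorComm, hslice,
          hslice, LinearMap.mul'_apply]
  · ext1 b
    rw [← sub_eq_zero]
    refine hsep _ fun w => ?_
    rw [map_sub, sub_eq_zero]
    refine Eq.trans ?_ (LinearMap.congr_fun (congrArg ofConv (counit_coactionSlice hω hπ hp w)) b)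
    rw [convPost_apply, ← hslice]
    simp only [LinearMap.comp_apply]
    generalize lam b = t
    induction t with
    | zero => simp
    | add x y hx hy => simp only [map_add, hx, hy]
    | tmul x y => simp [mul_comm]
  · ext1 b
    refine eq_of_lTensor_eq (fun w => slice H (cofreeLiftAlg p w).ofConv) hsep2 fun w => ?_
    obtain ⟨d, rfl⟩ := hπ b
    rw [LinearMap.comp_apply, lTensor_slice_coaction hω hπ hp hlam,
      conj_coactionSlice_eq_mul_comul hω hp, convPre_apply, LinearMap.convMul_apply,
      coactionNabla_eq hω hπ hp hlam]
    simp only [LinearMap.comp_apply]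
    generalize (Coalgebra.comul (π d) : B ⊗[k] B) = t
    induction t with
    | zero => simp
    | add x y hx hy => simp only [map_add, hx, hy]
    | tmul x y =>
      rw [TensorProduct.map_tmul, TensorProduct.map_tmul, lTensor_slice_mulLeftTensor,
        lTensor_slice_comulCoaction, hslice]
      rfl
  · ext1 b
    refine eq_of_lTensor_eq (fun w => slice H (cofreeLiftAlg p w).ofConv) hsep2 fun w => ?_
    obtain ⟨d, rfl⟩ := hπ b
    rw [LinearMap.comp_apply, lTensor_slice_coaction hω hπ hp hlam,
      conj_coactionSlice_eq_comul_mul hω hp, convPre_apply, LinearMap.convMul_apply,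
      coactionNabla_eq hω hπ hp hlam]
    simp only [LinearMap.comp_apply]
    generalize (Coalgebra.comul (π d) : B ⊗[k] B) = t
    induction t with
    | zero => simp
    | add x y hx hy => simp only [map_add, hx, hy]
    | tmul x y =>
      rw [TensorProduct.map_tmul, TensorProduct.map_tmul, lTensor_slice_mulRightTensor,
        lTensor_slice_comulCoaction, hslice]
      rfl

end Coaction

end Descent

/-! ### Subcoalgebras and sums of subcoalgebras -/

section Inclusion

variable {k D : Type*} [Field k] [AddCommGroup D] [Module k D] [Coalgebra k D]

/-- The inclusion of a subcoalgebra, as a coalgebra map. -/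
def Subcoalgebra.subtypeHom (X : Subcoalgebra k D) : X.toSubmodule →ₗc[k] D where
  toLinearMap := X.toSubmodule.subtype
  counit_comp := rfl
  map_comp_comul := LinearMap.ext X.map_subtype_comulRestrict

/-- A linear map into a subcoalgebra is a coalgebra map if its composition with the inclusion
is. -/
def Subcoalgebra.liftHom {B : Type*} [AddCommGroup B] [Module k B] [Coalgebra k B]
    (X : Subcoalgebra k D) (g : B →ₗ[k] X.toSubmodule) (f : B →ₗc[k] D) (h : ∀ b, (g b).1 = f b) :
    B →ₗc[k] X.toSubmodule where
  toLinearMap := g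
  counit_comp := by
    ext b
    refine (congrArg Coalgebra.counit (h b)).trans ?_
    exact LinearMap.congr_fun f.counit_comp b
  map_comp_comul := by
    ext1 b
    apply X.map_subtype_injective
    have hf : X.toSubmodule.subtype ∘ₗ g = f.toLinearMap := LinearMap.ext h
    refine Eq.trans ?_ (X.map_subtype_comulRestrict (g b)).symm
    rw [h, LinearMap.comp_apply, ← LinearMap.comp_apply, ← TensorProduct.map_comp, hf]
    exact LinearMap.congr_fun f.map_comp_comul b

/-- The coalgebra map induced by the restriction of `p` to a subcoalgebra of `C(V)` is the
inclusion, hence injective. -/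
theorem cofreeLift_proj_subtype_injective {V : Type*} [AddCommGroup V] [Module k V]
    (X : Subcoalgebra k (CofreeCoalgebra k V)) :
    Function.Injective (cofreeLift (cofreeProj k V ∘ₗ X.toSubmodule.subtype)) := by
  have h : cofreeLift (cofreeProj k V ∘ₗ X.toSubmodule.subtype) = X.subtypeHom :=
    (existsUnique_cofreeLift _).unique (cofreeProj_cofreeLift _) fun _ => rfl
  rw [h]
  exact Subtype.val_injective

end Inclusion

section Span

variable {k D : Type*} [Field k] [AddCommGroup D] [Module k D]

theorem eq_of_comp_eq {ι M : Type*} {X : ι → Type*} [∀ i, AddCommGroup (X i)]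
    [∀ i, Module k (X i)] [AddCommGroup M] [Module k M] (f : ∀ i, X i →ₗ[k] D)
    (hf : ⨆ i, LinearMap.range (f i) = ⊤) {F G : D →ₗ[k] M} (h : ∀ i, F ∘ₗ f i = G ∘ₗ f i) :
    F = G := by
  rw [← LinearMap.eqLocus_eq_top, eq_top_iff, ← hf]
  exact iSup_le fun i => by
    rintro _ ⟨x, rfl⟩
    exact LinearMap.congr_fun (h i) x

end Span

section Restriction

variable {k H D : Type*} [Field k] [Ring H] [HopfAlgebra k H]
  [AddCommGroup D] [Module k D] [Coalgebra k D]

theorem map_comul_comp {D' A A' : Type*} [AddCommGroup D'] [Module k D'] [Coalgebra k D']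
    [AddCommGroup A] [Module k A] [AddCommGroup A'] [Module k A'] (f : D →ₗ[k] A) (g : D →ₗ[k] A')
    (j : D' →ₗc[k] D) : (TensorProduct.map f g ∘ₗ Coalgebra.comul) ∘ₗ j.toLinearMap =
      TensorProduct.map (f ∘ₗ j.toLinearMap) (g ∘ₗ j.toLinearMap) ∘ₗ Coalgebra.comul := by
  rw [LinearMap.comp_assoc, ← j.map_comp_comul, ← LinearMap.comp_assoc, ← TensorProduct.map_comp]

theorem idempotentMap_comp {D' : Type*} [AddCommGroup D'] [Module k D'] [Coalgebra k D']
    (ω : D →ₗ[k] H) (j : D' →ₗc[k] D) :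
    idempotentMap ω ∘ₗ j.toLinearMap = idempotentMap (ω ∘ₗ j.toLinearMap) := by
  rw [idempotentMap, LinearMap.comp_assoc, map_comul_comp]
  rfl

/-- If the images of the coalgebra maps `j i : X i → D` span `D`, then a linear map on `D` is a
partial corepresentation as soon as its composition with each `j i` is. -/
theorem isPartialCorep_of_comp {ι : Type*} {X : ι → Type*} [∀ i, AddCommGroup (X i)]
    [∀ i, Module k (X i)] [∀ i, Coalgebra k (X i)] (j : ∀ i, X i →ₗc[k] D)
    (hj : ⨆ i, LinearMap.range (j i).toLinearMap = ⊤) {ω : D →ₗ[k] H}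
    (h : ∀ i, IsPartialCorep (ω ∘ₗ (j i).toLinearMap)) : IsPartialCorep ω := by
  constructor
  · refine eq_of_comp_eq _ hj fun i => ?_
    rw [(j i).counit_comp, LinearMap.comp_assoc, (h i).counit_comp]
  · refine eq_of_comp_eq _ hj fun i => ?_
    rw [map_comul_comp, idempotentMap_comp, ← (h i).comul_left, LinearMap.comp_assoc,
      LinearMap.comp_assoc, map_comul_comp]
    rfl
  · refine eq_of_comp_eq _ hj fun i => ?_
    rw [map_comul_comp, idempotentMap_comp, ← (h i).comul_right, LinearMap.comp_assoc,
      LinearMap.comp_assoc, map_comul_comp]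
    rfl

end Restriction

/-! ### The universal corep-coalgebra -/

section Universal

variable (k : Type*) [Field k] (H : Type*) [Ring H] [HopfAlgebra k H]

theorem isPartialCorep_hparProj : IsPartialCorep (hparProj k H) := by
  let Λ : Set (Subcoalgebra k (CofreeCoalgebra k H)) :=
    {X | IsPartialCorep (cofreeProj k H ∘ₗ X.toSubmodule.subtype)}
  have hle : ∀ X : Λ, X.1.toSubmodule ≤ (hpar k H).toSubmodule :=
    fun X => le_iSup₂_of_le X.1 X.2 le_rfl
  let j (X : Λ) : X.1.toSubmodule →ₗc[k] Hpar k H :=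
    (hpar k H).liftHom (Submodule.inclusion (hle X)) X.1.subtypeHom fun _ => rfl
  refine isPartialCorep_of_comp j ?_ fun X => X.2
  rw [eq_top_iff]
  have key : (hpar k H).toSubmodule ≤
      (⨆ X : Λ, LinearMap.range (j X).toLinearMap).map (hpar k H).toSubmodule.subtype :=
    iSup₂_le fun X hX x hx => ⟨j ⟨X, hX⟩ ⟨x, hx⟩,
      Submodule.mem_iSup_of_mem (p := fun X : Λ => LinearMap.range (j X).toLinearMap) ⟨X, hX⟩
        ⟨⟨x, hx⟩, rfl⟩, rfl⟩
  intro x _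
  obtain ⟨y, hy, hyx⟩ := key x.2
  rwa [Subtype.ext hyx] at hy

/-- The surjection `Ebar : H^par → C` as a coalgebra map. -/
def hparEbarHom : Hpar k H →ₗc[k] Base k H :=
  (baseCoalgebra k H).liftHom (hparEbar k H) (hparELift k H) fun _ => rfl

theorem hparEbarHom_surjective : Function.Surjective (hparEbarHom k H) :=
  (hparELift k H).toLinearMap.surjective_rangeRestrict

end Universal

end PartialHopf

end

theorem mainTheorem4 (k : Type*) [Field k] (H : Type*) [Ring H] [HopfAlgebra k H] :
    ∃ lam : PartialHopf.Base k H →ₗ[k] H ⊗[k] PartialHopf.Base k H,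
      (∀ x : PartialHopf.Hpar k H,
        lam (PartialHopf.hparEbar k H x) = PartialHopf.twistedCoaction k H x) ∧
      (∀ lam' : PartialHopf.Base k H →ₗ[k] H ⊗[k] PartialHopf.Base k H,
        (∀ x : PartialHopf.Hpar k H,
          lam' (PartialHopf.hparEbar k H x) = PartialHopf.twistedCoaction k H x) → lam' = lam) ∧
      PartialHopf.IsSymmetricPartialCoaction lam := by
  have hω := PartialHopf.isPartialCorep_hparProj k H
  have hπ := PartialHopf.hparEbarHom_surjective k H
  have hp : PartialHopf.convPre (PartialHopf.hparEbarHom k H) (WithConv.toConv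
      (PartialHopf.cofreeProj k H ∘ₗ (PartialHopf.baseCoalgebra k H).toSubmodule.subtype)) =
        WithConv.toConv (PartialHopf.idempotentMap (PartialHopf.hparProj k H)) := by
    ext x
    exact PartialHopf.cofreeProj_cofreeLift _ x
  have hinj := PartialHopf.cofreeLift_proj_subtype_injective (PartialHopf.baseCoalgebra k H)
  obtain ⟨lam, hlam⟩ := PartialHopf.exists_comp_eq_twistedMap hω hπ hp hinj
  refine ⟨lam, hlam, fun lam' h' => ?_,
    PartialHopf.isSymmetricPartialCoaction_of_twistedMap hω hπ hp hinj hlam⟩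
  ext1 b
  obtain ⟨x, rfl⟩ := hπ b
  exact (h' x).trans (hlam x).symm
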